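/- **Setting.** Let $m=2^{\lambda_0}m_0$ with $m_0$ odd and $\lambda_0\ge 0$, and put $\lambda=\lambda_0+2$, $N=2^{\lambda}$, so that $4m=Nm_0$. Let $D_{8m}=\langle x,y\mid x^{4m}=1,\ y^2=1,\ yxy=x^{-1}\rangle$. A set $\mathcal C\subseteq\mathbb F_2^{8m}$ of words $(a_{k,j})_{0\le k<4m,\ j=0,1}$ is a *binary left $D_{8m}$-code* if its image under $(a_{k,j})\mapsto\sum_k a_{k,0}x^k+\sum_k a_{k,1}x^ky$ is a left ideal of $\mathbb F_2[D_{8m}]$. Words are identified with pairs $(a_0(x),a_1(x))\in\mathcal A^2$, where $\mathcal A=\mathbb F_2[x]/\langle x^{4m}-1\rangle$ and $a_j(x)=\sum_k a_{k,j}x^k$. The dual $\mathcal C^\perp$ is taken with respect to the standard inner product of $\mathbb F_2^{8m}$. Write $x^{m_0}-1=\prod_{i=0}^{r}f_i(x)$ with pairwise coprime irreducible $f_i\in\mathbb F_2[x]$ of degree $d_i$, where $r=\rho+2\epsilon$, $f_0=x+1$, the polynomials $f_0,\dots,f_\rho$ are self-reciprocal ($f_i^*=f_i$, where $g^*(x)=x^{\deg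 g}g(x^{-1})$), and for $\rho+1\le i\le\rho+\epsilon$ the polynomial $f_i$ is not self-reciprocal and $f_i^*=f_{i+\epsilon}$. Let $A_i=\mathbb F_2[x]/\langle f_i(x)^{N}\rangle$, with elements represented by polynomials of degree $<Nd_i$. Choose $u_i,v_i$ with $u_iF_i+v_if_i=1$, $F_i=(x^{m_0}-1)/f_i$, and put $\varepsilon_i=u_i(x^{N})F_i(x^{N})\in\mathcal A$, $\mathcal A_i=\varepsilon_i\mathcal A$ and $\varphi_i:A_i\to\mathcal A_i$, $a(x)\mapsto\varepsilon_i(x)a(x)$. For a linear code $C_i$ of length $2$ over $A_i$ (a submodule of $A_i^2$) let $\mathcal A_i\Box C_i=\{(\varphi_i(\xi_0),\varphi_i(\xi_1))\mid(\xi_0,\xi_1)\in C_i\}\subseteq\mathcal A^2$. In all these rings $x^{-1}=x^{4m-1}$. The elements of $A_i/\langle f_i^s\rangle$ are represented by the polynomials of degree $<sd_i$; $f_i(A_i/\langle f_i^s\rangle)$ is the set of those divisible by $f_i$; and $\mathcal W_i^{(s)}$ is the set of those $w$ with $w(x)w(x^{-1})\equiv1\pmod{f_i^s}$. A *generator matrix*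 of a linear code is a matrix whose rows span the code and none of whose rows is a linear combination of the others; in addition, the zero matrix counts as a generator matrix of the zero code. **Theorem.** Let $\mathcal C$ be a binary left $D_{8m}$-code. Then $\mathcal C^\perp$ is a binary left $D_{8m}$-code, and $\mathcal C$ has a decomposition $\mathcal C=\bigoplus_{i=0}^{r}(\mathcal A_i\Box C_i)$ with linear codes $C_i$ of length $2$ over $A_i$. For every such decomposition, $$\mathcal C^\perp=\bigoplus_{i=0}^{r}(\mathcal A_i\Box Q_i)$$ with linear codes $Q_i$ of length $2$ over $A_i$ such that $Q_i$ is stable under $(a(x),b(x))\mapsto(b(x^{-1}),a(x^{-1}))$ for $0\le i\le\rho$, this map carries $Q_i$ onto $Q_{i+\epsilon}$ for $\rho+1\le i\le\rho+\epsilon$, and the following hold. ($\dagger$) For $0\le i\le\rho$, $C_i$ has a generator matrix $G_i$ of one of the forms I–V below, and whenever $G_i$ of such a form is a generator matrix of $C_i$, the matrix $H_i$ is a generator matrix of $Q_i$ (write $f=f_i$): * I. $G_i=(1,a)$, $H_i=(1,a)$, with $a\in\mathcal W_i^{(N)}$. * II. $G_i=(f^k,f^ka)$, $H_i=\begin{pmatrix}1&a\\0&f^{N-k}\end{pmatrix}$,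 with $1\le k\le N-1$, $a\in\mathcal W_i^{(N-k)}$. * III. $G_i=f^kI_2$, $H_i=f^{N-k}I_2$, with $0\le k\le N$. * IV. $G_i=\begin{pmatrix}1&c\\0&f^j\end{pmatrix}$, $H_i=(f^{N-j},f^{N-j}c)$, with $1\le j\le N-1$, $c\in\mathcal W_i^{(j)}$. * V. $G_i=\begin{pmatrix}f^k&f^kc\\0&f^{k+j}\end{pmatrix}$, $H_i=\begin{pmatrix}f^{N-k-j}&f^{N-k-j}c\\0&f^{N-k}\end{pmatrix}$, with $1\le k\le N-2$, $1\le j\le N-k-1$, $c\in\mathcal W_i^{(j)}$. ($\ddagger$) For $\rho+1\le i\le\rho+\epsilon$, $C_i$ has a generator matrix $G_i$ of one of the forms 1–9 below, and whenever $G_i$ of such a form is a generator matrix of $C_i$, the matrices $H_i$ and $H_{i+\epsilon}$ are generator matrices of $Q_i$ and $Q_{i+\epsilon}$ (write $f=f_i$, $g=f_{i+\epsilon}$, $d=d_i$, $\bar p=p(x^{-1})$): * 1. $G_i=(1,a)$; $H_i=(1,a)$, $H_{i+\epsilon}=(\bar a,1)$; $a\in A_i$. * 2. $G_i=(f^k,f^ka)$;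 $H_i=\begin{pmatrix}1&a\\0&f^{N-k}\end{pmatrix}$, $H_{i+\epsilon}=\begin{pmatrix}\bar a&1\\g^{N-k}&0\end{pmatrix}$; $1\le k\le N-1$, $a\in A_i/\langle f^{N-k}\rangle$. * 3. $G_i=(fb,1)$; $H_i=(fb,1)$, $H_{i+\epsilon}=(1,g\,x^{-d}\bar b)$; $b\in A_i/\langle f^{N-1}\rangle$. * 4. $G_i=(f^{k+1}b,f^k)$; $H_i=\begin{pmatrix}fb&1\\f^{N-k}&0\end{pmatrix}$, $H_{i+\epsilon}=\begin{pmatrix}1&g\,x^{-d}\bar b\\0&g^{N-k}\end{pmatrix}$; $1\le k\le N-1$, $b\in A_i/\langle f^{N-k-1}\rangle$. * 5. $G_i=f^kI_2$; $H_i=f^{N-k}I_2$, $H_{i+\epsilon}=g^{N-k}I_2$; $0\le k\le N$. * 6. $G_i=\begin{pmatrix}1&c\\0&f^j\end{pmatrix}$; $H_i=(f^{N-j},f^{N-j}c)$, $H_{i+\epsilon}=(g^{N-j}\bar c,g^{N-j})$; $1\le j\le N-1$, $c\in A_i/\langle f^j\rangle$. * 7. $G_i=\begin{pmatrix}f^k&f^kc\\0&f^{k+j}\end{pmatrix}$;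 $H_i=\begin{pmatrix}f^{N-k-j}&f^{N-k-j}c\\0&f^{N-k}\end{pmatrix}$, $H_{i+\epsilon}=\begin{pmatrix}g^{N-k-j}\bar c&g^{N-k-j}\\g^{N-k}&0\end{pmatrix}$; $1\le k\le N-2$, $1\le j\le N-k-1$, $c\in A_i/\langle f^j\rangle$. * 8. $G_i=\begin{pmatrix}c&1\\f^j&0\end{pmatrix}$; $H_i=(f^{N-j}c,f^{N-j})$, $H_{i+\epsilon}=(g^{N-j},g^{N-j}\bar c)$; $1\le j\le N-1$, $c\in f(A_i/\langle f^j\rangle)$. * 9. $G_i=\begin{pmatrix}f^kc&f^k\\f^{k+j}&0\end{pmatrix}$; $H_i=\begin{pmatrix}f^{N-k-j}c&f^{N-k-j}\\f^{N-k}&0\end{pmatrix}$, $H_{i+\epsilon}=\begin{pmatrix}g^{N-k-j}&g^{N-k-j}\bar c\\0&g^{N-k}\end{pmatrix}$; $1\le k\le N-2$, $1\le j\le N-k-1$, $c\in f(A_i/\langle f^j\rangle)$. -/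

import Mathlib

open Polynomial

noncomputable section

namespace DihedralCode

/-! ## Binary left dihedral codes and their duals -/

/-- Binary words `(a_{k,j})`, `0 ≤ k < 4m`, `j = 0, 1`, of length `8m`. -/
abbrev Word (m : ℕ) : Type := Fin (4 * m) × Fin 2 → ZMod 2

/-- The group algebra `𝔽₂[D_{8m}]`. -/
abbrev GroupAlg (m : ℕ) : Type := MonoidAlgebra (ZMod 2) (DihedralGroup (4 * m))

/-- The rotation `x` in `𝔽₂[D_{8m}]`. -/
def gx (m : ℕ) : GroupAlg m := MonoidAlgebra.of (ZMod 2) _ (DihedralGroup.r 1)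

/-- The reflection `y` in `𝔽₂[D_{8m}]`. -/
def gy (m : ℕ) : GroupAlg m := MonoidAlgebra.of (ZMod 2) _ (DihedralGroup.sr 0)

/-- `Ψ(a) = ∑ a_{k,0} x^k + ∑ a_{k,1} x^k y`. -/
def Psi (m : ℕ) (a : Word m) : GroupAlg m :=
  ∑ k : Fin (4 * m), a (k, 0) • gx m ^ (k : ℕ) +
    ∑ k : Fin (4 * m), a (k, 1) • (gx m ^ (k : ℕ) * gy m)

/-- `C` is a binary left `D_{8m}`-code: `Ψ(C)` is a left ideal of `𝔽₂[D_{8m}]`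
(for a noncommutative ring, Mathlib's `Ideal` means left ideal). -/
def IsLeftDihedralCode (m : ℕ) (C : Set (Word m)) : Prop :=
  ∃ I : Ideal (GroupAlg m), Psi m '' C = (I : Set (GroupAlg m))

/-- The dual code for the standard inner product of `𝔽₂^{8m}`. -/
def dualCode (m : ℕ) (C : Set (Word m)) : Set (Word m) :=
  {b | ∀ a ∈ C, ∑ p : Fin (4 * m) × Fin 2, a p * b p = 0}

/-! ## The factorization of `x^{m₀} - 1` -/

/-- The index set `{0, …, ρ + 2ε}`, cut into the blocks `0, …, ρ` (`Sum.inl`),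
`ρ + 1, …, ρ + ε` (`left`) and `ρ + ε + 1, …, ρ + 2ε` (`right`). -/
abbrev Idx (ρ ε : ℕ) : Type := Fin (ρ + 1) ⊕ (Fin ε ⊕ Fin ε)

/-- The index `i`, where `0 ≤ i ≤ ρ`. -/
abbrev self {ρ ε : ℕ} (i : Fin (ρ + 1)) : Idx ρ ε := Sum.inl i

/-- The index `i = ρ + 1 + j`, where `0 ≤ j < ε`. -/
abbrev left {ρ ε : ℕ} (j : Fin ε) : Idx ρ ε := Sum.inr (Sum.inl j)

/-- The index `i + ε = ρ + ε + 1 + j`, where `0 ≤ j < ε`. -/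
abbrev right {ρ ε : ℕ} (j : Fin ε) : Idx ρ ε := Sum.inr (Sum.inr j)

/-- The factorization of `x^{m₀} - 1` over `𝔽₂` into irreducible polynomials, listed with
`f_0 = x + 1` first, then the other self-reciprocal factors, then the reciprocal pairs; together
with Bezout coefficients `u_i F_i + v_i f_i = 1`, where `F_i = (x^{m₀} - 1) / f_i`. The reciprocal
polynomial `g^*(x) = x^{deg g} g(x^{-1})` is Mathlib's `Polynomial.reverse`. -/
structure Factorization (m₀ ρ ε : ℕ) where
  f : Idx ρ ε → (ZMod 2)[X]
  irreducible : ∀ i, Irreducible (f i)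
  coprime : Pairwise fun i j => IsCoprime (f i) (f j)
  prod_eq : ∏ i, f i = X ^ m₀ - 1
  zero_eq : f (self 0) = X + 1
  self_reverse : ∀ i, (f (self i)).reverse = f (self i)
  two_le_natDegree : ∀ i, i ≠ 0 → 2 ≤ (f (self i)).natDegree
  left_reverse_ne : ∀ j, (f (left j)).reverse ≠ f (left j)
  left_reverse : ∀ j, (f (left j)).reverse = f (right j)
  u : Idx ρ ε → (ZMod 2)[X]
  v : Idx ρ ε → (ZMod 2)[X]
  bezout : ∀ i, u i * ((X ^ m₀ - 1) / f i) + v i * f i = 1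

/-- The ring `𝒜 = 𝔽₂[x] / ⟨x^{4m} - 1⟩`. -/
abbrev CycRing (m : ℕ) : Type := AdjoinRoot (X ^ (4 * m) - 1 : (ZMod 2)[X])

section

variable {m₀ ρ ε : ℕ} (D : Factorization m₀ ρ ε) (m l : ℕ)

/-- The ring `A_i = 𝔽₂[x] / ⟨f_i(x)^{2^l}⟩`. -/
abbrev LocRing (i : Idx ρ ε) : Type := AdjoinRoot (D.f i ^ 2 ^ l)

theorem monic_of_ne_zero {p : (ZMod 2)[X]} (hp : p ≠ 0) : p.Monic := by
  have h : p.leadingCoeff ≠ 0 := leadingCoeff_ne_zero.mpr hp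
  have key : ∀ z : ZMod 2, z ≠ 0 → z = 1 := by decide
  exact key _ h

theorem monic_pow (i : Idx ρ ε) : (D.f i ^ 2 ^ l).Monic :=
  monic_of_ne_zero (pow_ne_zero _ (D.irreducible i).ne_zero)

/-- The polynomial of degree `< 2^l d_i` that represents an element of `A_i`. -/
def rep (i : Idx ρ ε) : LocRing D l i →ₗ[ZMod 2] (ZMod 2)[X] :=
  AdjoinRoot.modByMonicHom (monic_pow D l i)

/-- The class of the polynomial `p(x)` in `A_i`. -/
abbrev cls (i : Idx ρ ε) (p : (ZMod 2)[X]) : LocRing D l i := AdjoinRoot.mk (D.f i ^ 2 ^ l) p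

/-- The class of `f_i(x)` in `A_i`. -/
abbrev fc (i : Idx ρ ε) : LocRing D l i := cls D l i (D.f i)

/-- `x^{-1} = x^{4m-1}` in `A_i`. -/
abbrev xinv (i : Idx ρ ε) : LocRing D l i := AdjoinRoot.root (D.f i ^ 2 ^ l) ^ (4 * m - 1)

/-- The value `p(x^{-1})` in `A_i` of a polynomial `p(x)`. -/
def evalInv (i : Idx ρ ε) (p : (ZMod 2)[X]) : LocRing D l i := aeval (xinv D m l i) p

/-! ## Concatenated codes -/

/-- A linear code of length `2` over `A_i`. -/
abbrev LinCode (i : Idx ρ ε) : Type := Submodule (LocRing D l i) (Fin 2 → LocRing D l i)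

/-- `ε_i(x) = u_i(x^{2^l}) F_i(x^{2^l})` in `𝒜`. -/
def idem (i : Idx ρ ε) : CycRing m :=
  AdjoinRoot.mk _
    ((D.u i).comp (X ^ 2 ^ l) * ((X ^ m₀ - 1 : (ZMod 2)[X]) / D.f i).comp (X ^ 2 ^ l))

/-- `φ_i : A_i → 𝒜`, `a(x) ↦ ε_i(x) a(x)`. -/
def phi (i : Idx ρ ε) : LocRing D l i →ₗ[ZMod 2] CycRing m :=
  (LinearMap.mulLeft (ZMod 2) (idem D m l i)).comp
    ((AdjoinRoot.mkₐ (X ^ (4 * m) - 1 : (ZMod 2)[X])).toLinearMap.restrictScalars (ZMod 2) |>.comp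
      (rep D l i))

/-- The concatenated code `𝒜_i □ C_i = {(φ_i(ξ₀), φ_i(ξ₁)) | (ξ₀, ξ₁) ∈ C_i} ⊆ 𝒜²`. -/
def concat (i : Idx ρ ε) (C : LinCode D l i) : Submodule (ZMod 2) (Fin 2 → CycRing m) :=
  (C.restrictScalars (ZMod 2)).map ((phi D m l i).compLeft (Fin 2))

/-- The identification of `𝔽₂^{8m}` with `𝒜²`: the word `(a_{k,j})` is the pair
`(a_0(x), a_1(x))` with `a_j(x) = ∑ a_{k,j} x^k`. -/
def toPair (a : Word m) : Fin 2 → CycRing m := fun j =>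
  ∑ k : Fin (4 * m), a (k, j) • AdjoinRoot.root (X ^ (4 * m) - 1 : (ZMod 2)[X]) ^ (k : ℕ)

/-- `C = ⨁_i (𝒜_i □ C_i)`, an internal direct sum over all `i = 0, …, ρ + 2ε`. -/
def IsDecomposition (C : Set (Word m)) (Cs : ∀ i, LinCode D l i) : Prop :=
  toPair m '' C = ((⨆ i, concat D m l i (Cs i) : Submodule (ZMod 2) (Fin 2 → CycRing m)) :
      Set (Fin 2 → CycRing m)) ∧
    iSupIndep fun i => concat D m l i (Cs i)

/-- `(a(x), b(x)) ∈ A_i² ↦ (b(x^{-1}), a(x^{-1})) ∈ A_j²`. -/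
def swapInv (i j : Idx ρ ε) (w : Fin 2 → LocRing D l i) : Fin 2 → LocRing D l j :=
  ![evalInv D m l j (rep D l i (w 1)), evalInv D m l j (rep D l i (w 0))]

/-- The canonical form decomposition of a left `D_{8m}`-code: `C = ⨁_i (𝒜_i □ C_i)`, where `C_i`
is stable under `(a(x), b(x)) ↦ (b(x^{-1}), a(x^{-1}))` for `0 ≤ i ≤ ρ`, and this map carries
`C_i` onto `C_{i+ε}` for `ρ + 1 ≤ i ≤ ρ + ε`. -/
def IsCanonicalForm (C : Set (Word m)) (Cs : ∀ i, LinCode D l i) : Prop :=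
  IsDecomposition D m l C Cs ∧
    (∀ i : Fin (ρ + 1), ∀ w ∈ Cs (self i), swapInv D m l (self i) (self i) w ∈ Cs (self i)) ∧
    (∀ j : Fin ε, (Cs (right j) : Set (Fin 2 → LocRing D l (right j))) =
      swapInv D m l (left j) (right j) '' (Cs (left j) : Set (Fin 2 → LocRing D l (left j))))

/-! ## Generator matrices -/

/-- `G` is a generator matrix of `C`: its rows span `C`, and no row is a linear combination of the
other rows. The zero matrix is admitted as generator matrix of the zero code. -/
def IsGeneratorMatrix {R : Type} [CommRing R] {r : ℕ} (G : Matrix (Fin r) (Fin 2) R)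
    (C : Submodule R (Fin 2 → R)) : Prop :=
  Submodule.span R (Set.range G.row) = C ∧
    (G = 0 ∨ ∀ t, G.row t ∉ Submodule.span R (G.row '' {t}ᶜ))

/-- The polynomials of degree `< s d_i`, which represent `A_i / ⟨f_i(x)^s⟩ = 𝔽₂[x] / ⟨f_i(x)^s⟩`. -/
def Res (i : Idx ρ ε) (s : ℕ) : Set (ZMod 2)[X] :=
  {p | p.degree < ((s * (D.f i).natDegree : ℕ) : WithBot ℕ)}

/-- The set `f_i(x) (A_i / ⟨f_i(x)^s⟩)` of multiples of `f_i(x)` in `A_i / ⟨f_i(x)^s⟩`. -/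
def ResMul (i : Idx ρ ε) (s : ℕ) : Set (ZMod 2)[X] := {p | p ∈ Res D i s ∧ D.f i ∣ p}

/-- The set `𝒲_i^{(s)}` of all `w(x)` in `𝔽₂[x] / ⟨f_i(x)^s⟩` with
`w(x) w(x^{-1}) ≡ 1 (mod f_i(x)^s)`, where `x^{-1} = x^{4m-1}`. -/
def W (i : Idx ρ ε) (s : ℕ) : Set (ZMod 2)[X] :=
  {w | w ∈ Res D i s ∧ D.f i ^ s ∣ w * w.comp (X ^ (4 * m - 1)) - 1}

/-- `SelfCase D m l i G H`, for `0 ≤ i ≤ ρ`: `G = G_i` has one of the five forms I, …, V, and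
`H = H_i` is the matrix that belongs to it. -/
inductive SelfCase (i : Fin (ρ + 1)) : {r s : ℕ} →
    Matrix (Fin r) (Fin 2) (LocRing D l (self i)) →
    Matrix (Fin s) (Fin 2) (LocRing D l (self i)) → Prop
  | I (a : (ZMod 2)[X]) (ha : a ∈ W D m (self i) (2 ^ l)) :
      SelfCase i !![1, cls D l (self i) a] !![1, cls D l (self i) a]
  | II (k : ℕ) (hk : 1 ≤ k) (hk' : k ≤ 2 ^ l - 1)
      (a : (ZMod 2)[X]) (ha : a ∈ W D m (self i) (2 ^ l - k)) :
      SelfCase i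
        !![fc D l (self i) ^ k, fc D l (self i) ^ k * cls D l (self i) a]
        !![1, cls D l (self i) a;
           0, fc D l (self i) ^ (2 ^ l - k)]
  | III (k : ℕ) (hk : k ≤ 2 ^ l) :
      SelfCase i
        !![fc D l (self i) ^ k, 0;
           0, fc D l (self i) ^ k]
        !![fc D l (self i) ^ (2 ^ l - k), 0;
           0, fc D l (self i) ^ (2 ^ l - k)]
  | IV (j : ℕ) (hj : 1 ≤ j) (hj' : j ≤ 2 ^ l - 1)
      (c : (ZMod 2)[X]) (hc : c ∈ W D m (self i) j) :
      SelfCase i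
        !![1, cls D l (self i) c;
           0, fc D l (self i) ^ j]
        !![fc D l (self i) ^ (2 ^ l - j), fc D l (self i) ^ (2 ^ l - j) * cls D l (self i) c]
  | V (k j : ℕ) (hk : 1 ≤ k) (hk' : k ≤ 2 ^ l - 2) (hj : 1 ≤ j) (hj' : j ≤ 2 ^ l - k - 1)
      (c : (ZMod 2)[X]) (hc : c ∈ W D m (self i) j) :
      SelfCase i
        !![fc D l (self i) ^ k, fc D l (self i) ^ k * cls D l (self i) c;
           0, fc D l (self i) ^ (k + j)]
        !![fc D l (self i) ^ (2 ^ l - k - j),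
             fc D l (self i) ^ (2 ^ l - k - j) * cls D l (self i) c;
           0, fc D l (self i) ^ (2 ^ l - k)]

/-- `PairCase D m l t G H H'`, for `i = ρ + 1 + t`: `G = G_i` has one of the nine standard forms of
generator matrices of linear codes of length `2` over `A_i`, and `H = H_i`, `H' = H_{i+ε}` are the
matrices that belong to it. -/
inductive PairCase (t : Fin ε) : {r s : ℕ} →
    Matrix (Fin r) (Fin 2) (LocRing D l (left t)) →
    Matrix (Fin s) (Fin 2) (LocRing D l (left t)) →
    Matrix (Fin s) (Fin 2) (LocRing D l (right t)) → Prop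
  | case1 (a : (ZMod 2)[X]) (ha : a ∈ Res D (left t) (2 ^ l)) :
      PairCase t
        !![1, cls D l (left t) a]
        !![1, cls D l (left t) a]
        !![evalInv D m l (right t) a, 1]
  | case2 (k : ℕ) (hk : 1 ≤ k) (hk' : k ≤ 2 ^ l - 1)
      (a : (ZMod 2)[X]) (ha : a ∈ Res D (left t) (2 ^ l - k)) :
      PairCase t
        !![fc D l (left t) ^ k, fc D l (left t) ^ k * cls D l (left t) a]
        !![1, cls D l (left t) a;
           0, fc D l (left t) ^ (2 ^ l - k)]
        !![evalInv D m l (right t) a, 1;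
           fc D l (right t) ^ (2 ^ l - k), 0]
  | case3 (b : (ZMod 2)[X]) (hb : b ∈ Res D (left t) (2 ^ l - 1)) :
      PairCase t
        !![fc D l (left t) * cls D l (left t) b, 1]
        !![fc D l (left t) * cls D l (left t) b, 1]
        !![1, fc D l (right t) *
             (xinv D m l (right t) ^ (D.f (left t)).natDegree * evalInv D m l (right t) b)]
  | case4 (k : ℕ) (hk : 1 ≤ k) (hk' : k ≤ 2 ^ l - 1)
      (b : (ZMod 2)[X]) (hb : b ∈ Res D (left t) (2 ^ l - k - 1)) :
      PairCase t
        !![fc D l (left t) ^ (k + 1) * cls D l (left t) b, fc D l (left t) ^ k]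
        !![fc D l (left t) * cls D l (left t) b, 1;
           fc D l (left t) ^ (2 ^ l - k), 0]
        !![1, fc D l (right t) *
             (xinv D m l (right t) ^ (D.f (left t)).natDegree * evalInv D m l (right t) b);
           0, fc D l (right t) ^ (2 ^ l - k)]
  | case5 (k : ℕ) (hk : k ≤ 2 ^ l) :
      PairCase t
        !![fc D l (left t) ^ k, 0;
           0, fc D l (left t) ^ k]
        !![fc D l (left t) ^ (2 ^ l - k), 0;
           0, fc D l (left t) ^ (2 ^ l - k)]
        !![fc D l (right t) ^ (2 ^ l - k), 0;
           0, fc D l (right t) ^ (2 ^ l - k)]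
  | case6 (j : ℕ) (hj : 1 ≤ j) (hj' : j ≤ 2 ^ l - 1)
      (c : (ZMod 2)[X]) (hc : c ∈ Res D (left t) j) :
      PairCase t
        !![1, cls D l (left t) c;
           0, fc D l (left t) ^ j]
        !![fc D l (left t) ^ (2 ^ l - j), fc D l (left t) ^ (2 ^ l - j) * cls D l (left t) c]
        !![fc D l (right t) ^ (2 ^ l - j) * evalInv D m l (right t) c,
           fc D l (right t) ^ (2 ^ l - j)]
  | case7 (k j : ℕ) (hk : 1 ≤ k) (hk' : k ≤ 2 ^ l - 2) (hj : 1 ≤ j) (hj' : j ≤ 2 ^ l - k - 1)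
      (c : (ZMod 2)[X]) (hc : c ∈ Res D (left t) j) :
      PairCase t
        !![fc D l (left t) ^ k, fc D l (left t) ^ k * cls D l (left t) c;
           0, fc D l (left t) ^ (k + j)]
        !![fc D l (left t) ^ (2 ^ l - k - j),
             fc D l (left t) ^ (2 ^ l - k - j) * cls D l (left t) c;
           0, fc D l (left t) ^ (2 ^ l - k)]
        !![fc D l (right t) ^ (2 ^ l - k - j) * evalInv D m l (right t) c,
             fc D l (right t) ^ (2 ^ l - k - j);
           fc D l (right t) ^ (2 ^ l - k), 0]
  | case8 (j : ℕ) (hj : 1 ≤ j) (hj' : j ≤ 2 ^ l - 1)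
      (c : (ZMod 2)[X]) (hc : c ∈ ResMul D (left t) j) :
      PairCase t
        !![cls D l (left t) c, 1;
           fc D l (left t) ^ j, 0]
        !![fc D l (left t) ^ (2 ^ l - j) * cls D l (left t) c, fc D l (left t) ^ (2 ^ l - j)]
        !![fc D l (right t) ^ (2 ^ l - j),
           fc D l (right t) ^ (2 ^ l - j) * evalInv D m l (right t) c]
  | case9 (k j : ℕ) (hk : 1 ≤ k) (hk' : k ≤ 2 ^ l - 2) (hj : 1 ≤ j) (hj' : j ≤ 2 ^ l - k - 1)
      (c : (ZMod 2)[X]) (hc : c ∈ ResMul D (left t) j) :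
      PairCase t
        !![fc D l (left t) ^ k * cls D l (left t) c, fc D l (left t) ^ k;
           fc D l (left t) ^ (k + j), 0]
        !![fc D l (left t) ^ (2 ^ l - k - j) * cls D l (left t) c,
             fc D l (left t) ^ (2 ^ l - k - j);
           fc D l (left t) ^ (2 ^ l - k), 0]
        !![fc D l (right t) ^ (2 ^ l - k - j),
             fc D l (right t) ^ (2 ^ l - k - j) * evalInv D m l (right t) c;
           0, fc D l (right t) ^ (2 ^ l - k)]

end

end DihedralCode

end

/-!
The group algebra `𝔽₂[D_{8m}]` is identified with `𝒜²` through `(a, b) ↦ a(x) + b(x) y`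
(`pairToGroupAlg`). Left multiplication by `y` then becomes `(a, b) ↦ (b(x⁻¹), a(x⁻¹))`
(`cycSwap`), and left codes are exactly the `𝒜`-submodules of `𝒜²` stable under this map
(`isLeftDihedralCode_iff`).

The standard inner product of two words is the constant coefficient of
`a₀(x) b₀(x⁻¹) + a₁(x) b₁(x⁻¹)`. For a code that is an `𝒜`-submodule the whole polynomial must
vanish, and for one that is also stable under `y` the inversion can be moved away: the dual code is
the orthogonal for the alternating form `a₀ b₁ - a₁ b₀` (`toPair_image_dualCode`; signs are
immaterial in characteristic two). This form involves no inversion, so the orthogonal can be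
computed separately in each factor of `𝒜 ≅ ∏ A_i` (`altDual_glue`), and `Q_i` is the orthogonal of
`C_i`.

Each `A_i` is a finite chain ring with uniformizer `p = f_i` and nilpotency index `N`. Over such a
ring every code of length two is, up to an exchange of the coordinates, spanned by `p ^ k (1, c)`
and `p ^ (k + j) (0, 1)` (`stdCode`, `IsChainRing.exists_normalForm`), and the orthogonal of this
code is the code of the same shape with `N - k - j` in place of `k`
(`IsChainRing.altDual_stdCode`). All the forms of `SelfCase` and `PairCase` are instances of this
one shape. For a self-reciprocal `f_i`, stability forces `c(x) c(x⁻¹) ≡ 1` modulo `p ^ j`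
(`mem_W_of_stable`) and rules out the nonscalar forms with exchanged coordinates
(`not_stable_colSwap`). For a reciprocal pair, `Q_{i+ε}` is the image of `Q_i` under
`(a, b) ↦ (b(x⁻¹), a(x⁻¹))`, which is again of standard shape because `f_i(x⁻¹)` and `f_{i+ε}(x)`
differ by a power of `x` (`swapInv_image_stdCode`).
-/

open Polynomial

noncomputable section

namespace DihedralCode

/-! ### Codes of length two over a finite chain ring -/

section ChainRing

variable {R : Type} [CommRing R]

/-- `R` is a chain ring with uniformizer `p` of nilpotency index `N`: every non-unit is a multiple
of `p`, and `N` is the least exponent with `p ^ N = 0`. Finiteness of `R` is not part of the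
definition. -/
structure IsChainRing (p : R) (N : ℕ) : Prop where
  isUnit_or_dvd : ∀ r, IsUnit r ∨ p ∣ r
  pow_eq_zero : p ^ N = 0
  pow_ne_zero : ∀ k < N, p ^ k ≠ 0

namespace IsChainRing

variable {p : R} {N : ℕ} (h : IsChainRing p N)
include h

theorem exists_eq_pow_mul (r : R) : ∃ n ≤ N, ∃ u : Rˣ, r = p ^ n * u := by
  classical
  set n := Nat.findGreatest (fun n => p ^ n ∣ r) N with hn
  have hle : n ≤ N := Nat.findGreatest_le N
  have hd : p ^ n ∣ r := Nat.findGreatest_spec (P := fun n => p ^ n ∣ r) (Nat.zero_le N) (by simp)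
  obtain ⟨s, hs⟩ := hd
  rcases hle.eq_or_lt with h1 | h1
  · exact ⟨N, le_rfl, 1, by rw [hs, h1, h.pow_eq_zero]; simp⟩
  · rcases h.isUnit_or_dvd s with ⟨u, hu⟩ | ⟨t, ht⟩
    · exact ⟨n, hle, u, by rw [hs, hu]⟩
    · exfalso
      refine Nat.findGreatest_is_greatest (P := fun n => p ^ n ∣ r) (n := N) (k := n + 1)
        (Nat.lt_succ_self _) h1 ⟨t, ?_⟩
      rw [hs, ht, pow_succ, mul_assoc]

theorem pow_eq_zero_of_le {k : ℕ} (hk : N ≤ k) : p ^ k = 0 :=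
  _root_.pow_eq_zero_of_le hk h.pow_eq_zero

theorem dvd_of_pow_mul_eq_zero {k : ℕ} {r : R} (hr : p ^ k * r = 0) : p ^ (N - k) ∣ r := by
  obtain ⟨n, -, u, rfl⟩ := h.exists_eq_pow_mul r
  have h0 : p ^ (k + n) = 0 := by
    rw [← mul_assoc, ← pow_add] at hr
    exact (Units.mul_left_eq_zero u).mp hr
  have : N ≤ k + n := by
    by_contra hlt
    exact h.pow_ne_zero _ (not_le.mp hlt) h0
  exact Dvd.dvd.mul_right (pow_dvd_pow p (by omega)) _

theorem le_of_pow_dvd_pow {a b : ℕ} (hb : b < N) (hd : p ^ a ∣ p ^ b) : a ≤ b := by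
  by_contra hlt
  obtain ⟨z, hz⟩ := hd
  refine h.pow_ne_zero (N - 1) (by omega) ?_
  have e : p ^ (N - 1) = p ^ (N - 1 - b) * p ^ b := by rw [← pow_add]; congr 1; omega
  rw [e, hz, ← mul_assoc, ← pow_add, h.pow_eq_zero_of_le (by omega), zero_mul]

/-- The ideals of a finite chain ring are the powers of its maximal ideal. -/
theorem exists_ideal_eq (J : Submodule R R) : ∃ e ≤ N, ∀ r, r ∈ J ↔ p ^ e ∣ r := by
  classical
  have hex : ∃ e, p ^ e ∈ J := ⟨N, by rw [h.pow_eq_zero]; exact J.zero_mem⟩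
  refine ⟨Nat.find hex, Nat.find_min' hex (by rw [h.pow_eq_zero]; exact J.zero_mem), fun r => ?_⟩
  constructor
  · intro hr
    obtain ⟨n, -, u, rfl⟩ := h.exists_eq_pow_mul r
    have : p ^ n ∈ J := by
      have := J.smul_mem (↑u⁻¹ : R) hr
      simpa [smul_eq_mul, mul_comm, mul_assoc] using this
    exact Dvd.dvd.mul_right (pow_dvd_pow p (Nat.find_min' hex this)) _
  · rintro ⟨s, rfl⟩
    rw [mul_comm]
    exact J.smul_mem s (Nat.find_spec hex)

end IsChainRing

/-- The code spanned by `p ^ k (1, c)` and `p ^ (k + j) (0, 1)`. -/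
def stdCode (p : R) (k j : ℕ) (c : R) : Submodule R (Fin 2 → R) :=
  Submodule.span R {![p ^ k, p ^ k * c], ![0, p ^ (k + j)]}

theorem mem_stdCode {p : R} {k j : ℕ} {c : R} {w : Fin 2 → R} :
    w ∈ stdCode p k j c ↔ ∃ t s, w 0 = p ^ k * t ∧ w 1 = p ^ k * t * c + p ^ (k + j) * s := by
  rw [stdCode, Submodule.mem_span_pair]
  constructor
  · rintro ⟨t, s, rfl⟩
    refine ⟨t, s, ?_, ?_⟩ <;> simp <;> ring
  · rintro ⟨t, s, h0, h1⟩
    refine ⟨t, s, ?_⟩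
    ext i
    fin_cases i
    · simp [h0]; ring
    · simp [h1]; ring

/-- The code obtained by exchanging the two coordinates. -/
def colSwap (C : Submodule R (Fin 2 → R)) : Submodule R (Fin 2 → R) :=
  C.comap (LinearMap.funLeft R R (Equiv.swap (0 : Fin 2) 1))

theorem mem_colSwap {C : Submodule R (Fin 2 → R)} {w : Fin 2 → R} :
    w ∈ colSwap C ↔ ![w 1, w 0] ∈ C := by
  have : LinearMap.funLeft R R (Equiv.swap (0 : Fin 2) 1) w = ![w 1, w 0] := by
    ext i; fin_cases i <;> simp [LinearMap.funLeft_apply]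
  rw [colSwap, Submodule.mem_comap, this]

theorem vec_eta {α : Type} (w : Fin 2 → α) : ![w 0, w 1] = w := by
  ext i; fin_cases i <;> rfl

theorem colSwap_colSwap (C : Submodule R (Fin 2 → R)) : colSwap (colSwap C) = C := by
  ext w
  simp [mem_colSwap, vec_eta]

theorem mem_colSwap_stdCode {p : R} {k j : ℕ} {c : R} {w : Fin 2 → R} :
    w ∈ colSwap (stdCode p k j c) ↔
      ∃ t s, w 1 = p ^ k * t ∧ w 0 = p ^ k * t * c + p ^ (k + j) * s := by
  rw [mem_colSwap, mem_stdCode]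
  simp

/-- The orthogonal of a code for the alternating form `v₀ w₁ - v₁ w₀`. -/
def altDual (C : Submodule R (Fin 2 → R)) : Submodule R (Fin 2 → R) where
  carrier := {w | ∀ v ∈ C, v 0 * w 1 - v 1 * w 0 = 0}
  add_mem' {a b} ha hb v hv := by
    have h1 := ha v hv
    have h2 := hb v hv
    simp only [Pi.add_apply]
    linear_combination h1 + h2
  zero_mem' v _ := by simp
  smul_mem' r w hw v hv := by
    have h1 := hw v hv
    simp only [Pi.smul_apply, smul_eq_mul]
    linear_combination r * h1

theorem mem_altDual {C : Submodule R (Fin 2 → R)} {w : Fin 2 → R} :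
    w ∈ altDual C ↔ ∀ v ∈ C, v 0 * w 1 - v 1 * w 0 = 0 := Iff.rfl

theorem altDual_colSwap (C : Submodule R (Fin 2 → R)) :
    altDual (colSwap C) = colSwap (altDual C) := by
  ext w
  simp only [mem_altDual, mem_colSwap]
  constructor
  · intro hw v hv
    have := hw ![v 1, v 0] (by simpa [vec_eta] using hv)
    simp at this ⊢
    linear_combination -this
  · intro hw v hv
    have := hw _ hv
    simp at this ⊢
    linear_combination -this

theorem stdCode_congr {p : R} {k j : ℕ} {c c' : R} (hc : p ^ j ∣ c - c') :
    stdCode p k j c = stdCode p k j c' := by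
  obtain ⟨z, hz⟩ := hc
  ext w
  simp only [mem_stdCode]
  constructor
  · rintro ⟨t, s, h0, h1⟩
    exact ⟨t, s + t * z, h0, by rw [h1, pow_add]; linear_combination p ^ k * t * hz⟩
  · rintro ⟨t, s, h0, h1⟩
    exact ⟨t, s - t * z, h0, by rw [h1, pow_add]; linear_combination -p ^ k * t * hz⟩

namespace IsChainRing

variable {p : R} {N : ℕ} (h : IsChainRing p N)
include h

theorem altDual_stdCode {k j : ℕ} (hkj : k + j ≤ N) (c : R) :
    altDual (stdCode p k j c) = stdCode p (N - k - j) j c := by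
  ext w
  rw [mem_altDual, mem_stdCode]
  constructor
  · intro hw
    have h1 := hw ![p ^ k, p ^ k * c] (Submodule.subset_span (by simp))
    have h2 := hw ![0, p ^ (k + j)] (Submodule.subset_span (by simp))
    simp at h1 h2
    obtain ⟨t, ht⟩ := h.dvd_of_pow_mul_eq_zero h2
    have h3 : p ^ k * (w 1 - c * w 0) = 0 := by linear_combination h1
    obtain ⟨s, hs⟩ := h.dvd_of_pow_mul_eq_zero h3
    have e1 : N - (k + j) = N - k - j := by omega
    have e2 : N - k = N - k - j + j := by omega
    rw [e1] at ht
    rw [e2] at hs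
    exact ⟨t, s, ht, by linear_combination hs + c * ht⟩
  · rintro ⟨t, s, h0, h1⟩ v hv
    obtain ⟨t', s', h0', h1'⟩ := mem_stdCode.mp hv
    have e1 : p ^ k * p ^ (N - k - j + j) = 0 := by
      rw [← pow_add]; exact h.pow_eq_zero_of_le (by omega)
    have e2 : p ^ (k + j) * p ^ (N - k - j) = 0 := by
      rw [← pow_add]; exact h.pow_eq_zero_of_le (by omega)
    rw [h0, h1, h0', h1']
    linear_combination t' * s * e1 - s' * t * e2

/-- A code all of whose entries are multiples of `p ^ k` and that contains a word whose first
entry is exactly `p ^ k` up to a unit is generated by a triangular matrix. -/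
theorem exists_eq_stdCode {k : ℕ} (hk : k ≤ N) {C : Submodule R (Fin 2 → R)}
    (hdvd : ∀ w ∈ C, p ^ k ∣ w 0 ∧ p ^ k ∣ w 1) {w : Fin 2 → R} (hw : w ∈ C) (u : Rˣ)
    (hu : w 0 = p ^ k * u) : ∃ j c, k + j ≤ N ∧ C = stdCode p k j c := by
  obtain ⟨c, hc⟩ := (hdvd _ (C.smul_mem (↑u⁻¹ : R) hw)).2
  have hw' : ![p ^ k, p ^ k * c] ∈ C := by
    convert C.smul_mem (↑u⁻¹ : R) hw using 1
    ext i
    fin_cases i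
    · simp [hu, mul_left_comm]
    · exact hc.symm
  let g : R →ₗ[R] (Fin 2 → R) := LinearMap.single R (fun _ => R) 1
  have hg : ∀ r, g r = ![0, r] := fun r => by ext i; fin_cases i <;> simp [g]
  obtain ⟨e, heN, he⟩ := h.exists_ideal_eq (C.comap g)
  simp only [Submodule.mem_comap, hg] at he
  have hek : k ≤ e := by
    rcases heN.eq_or_lt with rfl | hlt
    · exact hk
    · exact h.le_of_pow_dvd_pow hlt (by simpa using (hdvd _ ((he (p ^ e)).mpr dvd_rfl)).2)
  obtain ⟨j, rfl⟩ := Nat.exists_eq_add_of_le hek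
  refine ⟨j, c, heN, le_antisymm (fun v hv => ?_) ?_⟩
  · obtain ⟨t, ht⟩ := (hdvd v hv).1
    have hsub := C.sub_mem hv (C.smul_mem t hw')
    have : v - t • ![p ^ k, p ^ k * c] = ![0, v 1 - t * (p ^ k * c)] := by
      ext i; fin_cases i
      · simp [ht, mul_comm]
      · simp
    rw [this, he] at hsub
    obtain ⟨s, hs⟩ := hsub
    exact mem_stdCode.mpr ⟨t, s, ht, by linear_combination hs⟩
  · rw [stdCode, Submodule.span_le]
    rintro v (rfl | rfl)
    · exact hw'
    · exact (he _).mpr dvd_rfl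

/-- Normal form of the codes of length two over a finite chain ring. Here `p ^ k` is the greatest
common divisor of all entries of `C`; the first alternative occurs when it is attained in the
first coordinate. -/
theorem exists_normalForm (C : Submodule R (Fin 2 → R)) :
    (∃ k j c, k + j ≤ N ∧ C = stdCode p k j c) ∨
      ∃ k j c, 1 ≤ j ∧ k + j ≤ N ∧ p ∣ c ∧ C = colSwap (stdCode p k j c) := by
  classical
  let P : ℕ → Prop := fun k => ∀ w ∈ C, p ^ k ∣ w 0 ∧ p ^ k ∣ w 1
  set k := Nat.findGreatest P N with hkdef
  have hkN : k ≤ N := Nat.findGreatest_le N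
  have hk : P k := Nat.findGreatest_spec (P := P) (Nat.zero_le N) (fun w _ => by simp)
  rcases hkN.eq_or_lt with hk1 | hk1
  · left
    refine ⟨N, 0, 0, le_rfl, le_antisymm (fun w hw => ?_) ?_⟩
    · obtain ⟨⟨t, ht⟩, ⟨s, hs⟩⟩ := hk w hw
      rw [hk1] at ht hs
      exact mem_stdCode.mpr ⟨t, s, ht, by simpa using hs⟩
    · rw [stdCode, Submodule.span_le]
      rintro v (rfl | rfl) <;> simp [h.pow_eq_zero, show ![(0 : R), 0] = 0 by simp]
  · have hnot : ¬ P (k + 1) :=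
      Nat.findGreatest_is_greatest (P := P) (Nat.lt_succ_self _) hk1
    -- An entry that is a multiple of `p ^ k` but not of `p ^ (k + 1)` is `p ^ k` times a unit.
    have key : ∀ r, p ^ k ∣ r → ¬ p ^ (k + 1) ∣ r → ∃ u : Rˣ, r = p ^ k * u := by
      rintro r ⟨s, rfl⟩ hr
      rcases h.isUnit_or_dvd s with ⟨u, rfl⟩ | ⟨t, rfl⟩
      · exact ⟨u, rfl⟩
      · exact absurd ⟨t, by rw [pow_succ, mul_assoc]⟩ hr
    by_cases h0 : ∀ w ∈ C, p ^ (k + 1) ∣ w 0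
    · right
      have : ∃ w ∈ C, ¬ p ^ (k + 1) ∣ w 1 := by
        by_contra! hall
        exact hnot fun w hw => ⟨h0 w hw, hall w hw⟩
      obtain ⟨w, hw, hw1⟩ := this
      obtain ⟨u, hu⟩ := key _ (hk w hw).2 hw1
      obtain ⟨j, c, hj, hC⟩ := h.exists_eq_stdCode hk1.le (C := colSwap C)
        (fun v hv => by simpa using (hk _ (mem_colSwap.mp hv)).symm)
        (w := ![w 1, w 0]) (by simpa [mem_colSwap, vec_eta] using hw) u (by simpa using hu)
      have hmem : ∀ v ∈ stdCode p k j c, p ^ (k + 1) ∣ v 1 := fun v hv => by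
        rw [← hC, mem_colSwap] at hv
        simpa using h0 _ hv
      refine ⟨k, j, c, ?_, hj, ?_, by rw [← hC, colSwap_colSwap]⟩
      · have h2 := hmem ![0, p ^ (k + j)] (Submodule.subset_span (by simp))
        by_contra hj0
        have hj0 : j = 0 := by omega
        subst hj0
        have := h.le_of_pow_dvd_pow hk1 (by simpa using h2)
        omega
      · obtain ⟨z, hz⟩ := hmem ![p ^ k, p ^ k * c] (Submodule.subset_span (by simp))
        simp only [Matrix.cons_val_one, Matrix.cons_val_zero] at hz
        have h3 : p ^ k * (c - p * z) = 0 := by rw [pow_succ] at hz; linear_combination hz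
        have h4 : p ∣ c - p * z :=
          (dvd_pow_self p (by omega)).trans (h.dvd_of_pow_mul_eq_zero h3)
        simpa using dvd_add h4 (Dvd.intro z rfl)
    · left
      push Not at h0
      obtain ⟨w, hw, hw0⟩ := h0
      obtain ⟨u, hu⟩ := key _ (hk w hw).1 hw0
      obtain ⟨j, c, hj, hC⟩ := h.exists_eq_stdCode hk1.le hk hw u hu
      exact ⟨k, j, c, hj, hC⟩

end IsChainRing

/-! ### Generator matrices of the normal forms -/

theorem isGeneratorMatrix_row {C : Submodule R (Fin 2 → R)} {a b : R}
    (hC : Submodule.span R {![a, b]} = C) (hne : ![a, b] ≠ 0) :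
    IsGeneratorMatrix !![a, b] C := by
  have hr : ∀ t, (!![a, b] : Matrix (Fin 1) (Fin 2) R).row t = ![a, b] := fun t => by
    fin_cases t; rfl
  refine ⟨?_, Or.inr fun t => ?_⟩
  · rw [← hC]
    congr 1
    simp
  · have : ({t}ᶜ : Set (Fin 1)) = ∅ := by
      ext s; simp [Subsingleton.elim s t]
    rw [hr, this]
    simpa using hne

theorem isGeneratorMatrix_rows {C : Submodule R (Fin 2 → R)} {a b c d : R}
    (hC : Submodule.span R {![a, b], ![c, d]} = C)
    (h0 : ∀ t : R, t • ![c, d] ≠ ![a, b]) (h1 : ∀ t : R, t • ![a, b] ≠ ![c, d]) :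
    IsGeneratorMatrix !![a, b; c, d] C := by
  have hr0 : (!![a, b; c, d] : Matrix (Fin 2) (Fin 2) R).row 0 = ![a, b] := rfl
  have hr1 : (!![a, b; c, d] : Matrix (Fin 2) (Fin 2) R).row 1 = ![c, d] := rfl
  refine ⟨?_, Or.inr fun t => ?_⟩
  · rw [← hC]
    congr 1
    simp [Set.pair_comm]
  · have e0 : ({0}ᶜ : Set (Fin 2)) = {1} := by ext s; fin_cases s <;> simp
    have e1 : ({1}ᶜ : Set (Fin 2)) = {0} := by ext s; fin_cases s <;> simp
    fin_cases t
    · simpa [e0, hr0, hr1, Submodule.mem_span_singleton] using h0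
    · simpa [e1, hr0, hr1, Submodule.mem_span_singleton] using h1

theorem IsGeneratorMatrix.eq {r : ℕ} {G : Matrix (Fin r) (Fin 2) R}
    {C C' : Submodule R (Fin 2 → R)} (h : IsGeneratorMatrix G C) (h' : IsGeneratorMatrix G C') :
    C = C' := h.1.symm.trans h'.1

/-- Exchanging the columns of a generator matrix. -/
theorem IsGeneratorMatrix.colSwap {r : ℕ} {G : Matrix (Fin r) (Fin 2) R}
    {C : Submodule R (Fin 2 → R)} (h : IsGeneratorMatrix G C) :
    IsGeneratorMatrix (G.submatrix id (Equiv.swap (0 : Fin 2) 1)) (colSwap C) := by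
  let e : (Fin 2 → R) ≃ₗ[R] (Fin 2 → R) := LinearEquiv.funCongrLeft R R (Equiv.swap 0 1)
  have hmap : ∀ S, (Submodule.span R S).map (e : (Fin 2 → R) →ₗ[R] (Fin 2 → R)) =
      Submodule.span R (e '' S) := fun S => by rw [Submodule.map_span]; rfl
  have hrow : ∀ t, (G.submatrix id (Equiv.swap (0 : Fin 2) 1)).row t = e (G.row t) := fun t => rfl
  have hee : ∀ w, e (e w) = w := fun w => by
    ext i; fin_cases i <;> simp [e, LinearEquiv.funCongrLeft_apply, LinearMap.funLeft_apply]
  have hC : DihedralCode.colSwap C = C.map (e : (Fin 2 → R) →ₗ[R] (Fin 2 → R)) := by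
    ext w
    rw [Submodule.mem_map]
    constructor
    · intro hw
      exact ⟨e w, hw, hee w⟩
    · rintro ⟨v, hv, rfl⟩
      show e (e v) ∈ C
      rwa [hee]
  refine ⟨?_, h.2.imp (fun h0 => by rw [h0]; rfl) fun h1 t ht => h1 t ?_⟩
  · rw [hC, ← h.1, hmap, ← Set.range_comp]
    rfl
  · have himg : (G.submatrix id (Equiv.swap (0 : Fin 2) 1)).row '' {t}ᶜ = e '' (G.row '' {t}ᶜ) := by
      rw [Set.image_image]; rfl
    rw [hrow, himg, ← hmap, Submodule.mem_map] at ht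
    obtain ⟨v, hv, hvt⟩ := ht
    rwa [← e.injective hvt]

theorem IsGeneratorMatrix.colSwap_row {C : Submodule R (Fin 2 → R)} {a b : R}
    (h : IsGeneratorMatrix !![a, b] C) : IsGeneratorMatrix !![b, a] (DihedralCode.colSwap C) := by
  convert h.colSwap using 1
  ext i j; fin_cases i; fin_cases j <;> simp

theorem IsGeneratorMatrix.colSwap_rows {C : Submodule R (Fin 2 → R)} {a b c d : R}
    (h : IsGeneratorMatrix !![a, b; c, d] C) :
    IsGeneratorMatrix !![b, a; d, c] (DihedralCode.colSwap C) := by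
  convert h.colSwap using 1
  ext i j; fin_cases i <;> fin_cases j <;> simp

namespace IsChainRing

variable {p : R} {N : ℕ} (h : IsChainRing p N)
include h

theorem isGeneratorMatrix_one {k j : ℕ} (hk : k < N) (hj : k + j = N) {a b c : R}
    (ha : a = p ^ k) (hb : b = a * c) : IsGeneratorMatrix !![a, b] (stdCode p k j c) := by
  subst ha hb
  apply isGeneratorMatrix_row
  · have : (![0, 0] : Fin 2 → R) = 0 := by simp
    rw [stdCode, hj, h.pow_eq_zero, Set.pair_comm, this, Submodule.span_insert_zero]
  · intro h0
    exact h.pow_ne_zero k hk (congrFun h0 0)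

theorem isGeneratorMatrix_two {k j : ℕ} (hkj : k + j < N) {a b c d : R}
    (ha : a = p ^ k) (hb : b = a * c) (hd : d = p ^ (k + j)) :
    IsGeneratorMatrix !![a, b; 0, d] (stdCode p k j c) := by
  subst ha hb hd
  apply isGeneratorMatrix_rows rfl
  · intro t ht
    exact h.pow_ne_zero k (by omega) (by simpa using (congrFun ht 0).symm)
  · intro t ht
    have e0 : t * p ^ k = 0 := by simpa using congrFun ht 0
    have e1 : t * (p ^ k * c) = p ^ (k + j) := by simpa using congrFun ht 1
    refine h.pow_ne_zero _ hkj ?_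
    rw [← e1, ← mul_assoc, e0, zero_mul]

theorem isGeneratorMatrix_scalar {k : ℕ} (hk : k ≤ N) :
    IsGeneratorMatrix !![p ^ k, 0; 0, p ^ k] (stdCode p k 0 0) := by
  rcases hk.eq_or_lt with rfl | hlt
  -- For `k = N` this is the zero matrix, whose rows are not independent.
  · have hz : (!![p ^ k, 0; 0, p ^ k] : Matrix (Fin 2) (Fin 2) R) = 0 := by
      ext i j; fin_cases i <;> fin_cases j <;> simp [h.pow_eq_zero]
    refine ⟨?_, Or.inl hz⟩
    rw [hz]
    have h1 : stdCode p k 0 0 = ⊥ := by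
      rw [stdCode, Submodule.span_eq_bot]
      rintro v (rfl | rfl) <;> simp [h.pow_eq_zero]
    rw [h1, Submodule.span_eq_bot]
    rintro v ⟨t, rfl⟩
    rfl
  · exact h.isGeneratorMatrix_two (j := 0) hlt rfl (mul_zero _).symm rfl

end IsChainRing

end ChainRing

/-! ### The rings `A_i` and inversion of `x` -/

section LocRing

variable {m₀ ρ ε : ℕ} (D : Factorization m₀ ρ ε) (m l : ℕ)

theorem isChainRing_locRing (i : Idx ρ ε) : IsChainRing (fc D l i) (2 ^ l) where
  isUnit_or_dvd r := by
    obtain ⟨a, rfl⟩ := AdjoinRoot.mk_surjective r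
    by_cases hd : D.f i ∣ a
    · exact Or.inr (map_dvd _ hd)
    · left
      have hco : IsCoprime (D.f i ^ 2 ^ l) a :=
        (((D.irreducible i).coprime_iff_not_dvd).mpr hd).pow_left
      obtain ⟨s, t, hst⟩ := hco
      refine IsUnit.of_mul_eq_one (cls D l i t) ?_
      have := congrArg (AdjoinRoot.mk (D.f i ^ 2 ^ l)) hst
      rw [map_add, map_mul, map_mul, AdjoinRoot.mk_self, mul_zero, zero_add, map_one] at this
      rw [mul_comm, this]
  pow_eq_zero := by rw [← map_pow, AdjoinRoot.mk_self]
  pow_ne_zero k hk := by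
    rw [← map_pow, Ne, AdjoinRoot.mk_eq_zero,
      pow_dvd_pow_iff (D.irreducible i).ne_zero (D.irreducible i).not_isUnit]
    omega

theorem fc_pow_dvd_cls {i : Idx ρ ε} {s : ℕ} (hs : s ≤ 2 ^ l) {a : (ZMod 2)[X]}
    (h : fc D l i ^ s ∣ cls D l i a) : D.f i ^ s ∣ a := by
  obtain ⟨z, hz⟩ := h
  obtain ⟨b, rfl⟩ := AdjoinRoot.mk_surjective z
  rw [← map_pow, ← map_mul, AdjoinRoot.mk_eq_mk] at hz
  have := (pow_dvd_pow (D.f i) hs).trans hz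
  simpa using dvd_add this (Dvd.intro b rfl)

/-- Every residue modulo `f_i ^ s` has a representative of degree less than `s d_i`. -/
theorem exists_res (i : Idx ρ ε) (s : ℕ) (c : LocRing D l i) :
    ∃ a ∈ Res D i s, fc D l i ^ s ∣ c - cls D l i a := by
  obtain ⟨q, rfl⟩ := AdjoinRoot.mk_surjective c
  have hmon : (D.f i ^ s).Monic := monic_of_ne_zero (pow_ne_zero _ (D.irreducible i).ne_zero)
  refine ⟨q %ₘ (D.f i ^ s), ?_, ?_⟩
  · have := degree_modByMonic_lt q hmon
    rwa [degree_eq_natDegree hmon.ne_zero, natDegree_pow] at this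
  · rw [← map_sub, ← map_pow, modByMonic_eq_sub_mul_div, sub_sub_cancel]
    exact map_dvd _ (dvd_mul_right _ _)

/-- Dividing a reduced multiple of `f_i` by `f_i` gives a reduced polynomial. -/
theorem exists_res_of_mem_resMul {i : Idx ρ ε} {s : ℕ} (hs : 1 ≤ s) {a : (ZMod 2)[X]}
    (ha : a ∈ ResMul D i s) : ∃ b ∈ Res D i (s - 1), a = D.f i * b := by
  obtain ⟨h1, b, rfl⟩ := ha
  refine ⟨b, ?_, rfl⟩
  by_cases hb : b = 0
  · rw [hb, Res, Set.mem_ofPred_eq, degree_zero]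
    exact WithBot.bot_lt_coe _
  · have hf := (D.irreducible i).ne_zero
    simp only [Res, Set.mem_ofPred_eq] at h1 ⊢
    rw [degree_eq_natDegree (mul_ne_zero hf hb), natDegree_mul hf hb, Nat.cast_lt] at h1
    rw [degree_eq_natDegree hb, Nat.cast_lt]
    obtain ⟨t, rfl⟩ := Nat.exists_eq_add_of_le' hs
    rw [Nat.add_sub_cancel]
    rw [add_mul] at h1
    omega

variable {m l} (hm : 4 * m = 2 ^ l * m₀) (hm0 : 0 < m)

include hm in
theorem prod_pow_eq : ∏ i, D.f i ^ 2 ^ l = X ^ (4 * m) - 1 := by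
  rw [Finset.prod_pow, D.prod_eq, sub_pow_char_pow, one_pow, ← pow_mul, mul_comm, hm]

include hm in
theorem pow_dvd (i : Idx ρ ε) : D.f i ^ 2 ^ l ∣ X ^ (4 * m) - 1 := by
  rw [← prod_pow_eq D hm]
  exact Finset.dvd_prod_of_mem _ (Finset.mem_univ i)

include hm in
theorem root_pow_eq_one (i : Idx ρ ε) : AdjoinRoot.root (D.f i ^ 2 ^ l) ^ (4 * m) = 1 := by
  have := AdjoinRoot.mk_eq_zero.mpr (pow_dvd D hm i)
  rwa [map_sub, map_pow, AdjoinRoot.mk_X, map_one, sub_eq_zero] at this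

include hm hm0 in
theorem root_mul_xinv (i : Idx ρ ε) : AdjoinRoot.root (D.f i ^ 2 ^ l) * xinv D m l i = 1 := by
  rw [← pow_succ', Nat.sub_add_cancel (by omega), root_pow_eq_one D hm]

/-- The relation `f_i^* = f_j` between indices. -/
def IsReciprocal (i j : Idx ρ ε) : Prop := (D.f i).reverse = D.f j

theorem isReciprocal_self (i : Fin (ρ + 1)) : IsReciprocal D (self i) (self i) := D.self_reverse i

theorem isReciprocal_left (t : Fin ε) : IsReciprocal D (left t) (right t) := D.left_reverse t

include hm hm0 in
/-- `f_i(x⁻¹) = x^{-d_i} f_i^*(x)`. -/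
theorem evalInv_f {i j : Idx ρ ε} (h : IsReciprocal D i j) :
    evalInv D m l j (D.f i) = fc D l j * xinv D m l j ^ (D.f i).natDegree := by
  have h1 := root_mul_xinv D hm hm0 j
  let : Invertible (xinv D m l j) := ⟨AdjoinRoot.root _, h1, by rw [mul_comm]; exact h1⟩
  have := eval₂_reverse_mul_pow (algebraMap (ZMod 2) (LocRing D l j)) (xinv D m l j) (D.f i)
  rw [h] at this
  have e : (⅟(xinv D m l j)) = AdjoinRoot.root _ := rfl
  rw [e] at this
  rw [evalInv, aeval_def, ← this, ← aeval_def, AdjoinRoot.aeval_eq]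

include hm hm0 in
theorem isReciprocal_right (t : Fin ε) : IsReciprocal D (right t) (left t) := by
  have h1 : D.f (left t) ∣ X ^ (4 * m) - 1 :=
    (dvd_pow_self _ (by positivity)).trans (pow_dvd D hm _)
  have h2 : (D.f (left t)).coeff 0 ≠ 0 := by
    obtain ⟨g, hg⟩ := h1
    intro h0
    have := congrArg (fun p => p.coeff 0) hg
    simp [mul_coeff_zero, h0, coeff_X_pow, show 0 ≠ 4 * m by omega] at this
  rw [IsReciprocal, ← D.left_reverse t, reverse, reverse_natDegree,
    natTrailingDegree_eq_zero_of_constantCoeff_ne_zero h2, Nat.sub_zero, reverse]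
  ext n
  rw [coeff_reflect, coeff_reflect, revAt_invol]

/-- The ring homomorphism `a(x) ↦ a(x⁻¹)` from `A_i` to `A_j`, where `f_i^* = f_j`. -/
def locInv {i j : Idx ρ ε} (h : IsReciprocal D i j) (hm : 4 * m = 2 ^ l * m₀) (hm0 : 0 < m) :
    LocRing D l i →ₐ[ZMod 2] LocRing D l j :=
  AdjoinRoot.liftAlgHom _ (Algebra.ofId _ _) (xinv D m l j) (by
    have : evalInv D m l j (D.f i ^ 2 ^ l) = 0 := by
      rw [evalInv, map_pow, ← evalInv, evalInv_f D hm hm0 h, mul_pow, ← map_pow,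
        AdjoinRoot.mk_self, zero_mul]
    exact this)

variable {i j : Idx ρ ε} (h : IsReciprocal D i j)

theorem locInv_cls (p : (ZMod 2)[X]) :
    locInv D h hm hm0 (cls D l i p) = evalInv D m l j p := rfl

theorem cls_rep (a : LocRing D l i) : cls D l i (rep D l i a) = a :=
  AdjoinRoot.mk_leftInverse (monic_pow D l i) a

theorem evalInv_rep (a : LocRing D l i) : evalInv D m l j (rep D l i a) = locInv D h hm hm0 a := by
  rw [← locInv_cls D hm hm0 h, cls_rep]

theorem swapInv_eq (w : Fin 2 → LocRing D l i) :
    swapInv D m l i j w = ![locInv D h hm hm0 (w 1), locInv D h hm hm0 (w 0)] := by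
  rw [swapInv, evalInv_rep D hm hm0 h, evalInv_rep D hm hm0 h]

theorem locInv_root : locInv D h hm hm0 (AdjoinRoot.root _) = xinv D m l j :=
  AdjoinRoot.liftAlgHom_root _ _ _ _

theorem locInv_xinv : locInv D h hm hm0 (xinv D m l i) = AdjoinRoot.root _ := by
  have h1 := congrArg (locInv D h hm hm0) (root_mul_xinv D hm hm0 i)
  rw [map_mul, locInv_root, map_one] at h1
  calc _ = (AdjoinRoot.root _ * xinv D m l j) * locInv D h hm hm0 (xinv D m l i) := by
        rw [root_mul_xinv D hm hm0, one_mul]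
    _ = _ := by rw [mul_assoc, h1, mul_one]

theorem locInv_locInv (h' : IsReciprocal D j i) (a : LocRing D l i) :
    locInv D h' hm hm0 (locInv D h hm hm0 a) = a := by
  have : (locInv D h' hm hm0).comp (locInv D h hm hm0) = AlgHom.id _ _ := by
    apply AdjoinRoot.algHom_ext
    rw [AlgHom.comp_apply, locInv_root, locInv_xinv, AlgHom.id_apply]
  exact DFunLike.congr_fun this a

include hm hm0 h in
theorem swapInv_swapInv (h' : IsReciprocal D j i) (w : Fin 2 → LocRing D l i) :
    swapInv D m l j i (swapInv D m l i j w) = w := by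
  rw [swapInv_eq D hm hm0 h, swapInv_eq D hm hm0 h']
  simp [locInv_locInv D hm hm0 h h', vec_eta]

theorem locInv_fc : locInv D h hm hm0 (fc D l i) =
    fc D l j * xinv D m l j ^ (D.f i).natDegree := by
  rw [locInv_cls, evalInv_f D hm hm0 h]

/-- The substitution `x ↦ x⁻¹` followed by the exchange of the coordinates carries a code in normal
form to the code in normal form with the columns exchanged: `f_i(x⁻¹)` is `f_j(x)` times a unit. -/
theorem swapInv_image_stdCode (h' : IsReciprocal D j i) (k n : ℕ) (c : LocRing D l i) :
    swapInv D m l i j '' (stdCode (fc D l i) k n c : Set (Fin 2 → LocRing D l i)) =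
      colSwap (stdCode (fc D l j) k n (locInv D h hm hm0 c)) := by
  set φ := locInv D h hm hm0 with hφ
  set d := (D.f i).natDegree
  set e := xinv D m l j ^ d with he
  set e' : LocRing D l j := AdjoinRoot.root (D.f j ^ 2 ^ l) ^ d with he'
  have hee : e' * e = 1 := by rw [he, he', ← mul_pow, root_mul_xinv D hm hm0, one_pow]
  have hee' : ∀ n, e ^ n * e' ^ n = 1 := fun n => by
    rw [← mul_pow, mul_comm e, hee, one_pow]
  have hf : φ (fc D l i) = fc D l j * e := locInv_fc D hm hm0 h
  ext w
  simp only [Set.mem_image, SetLike.mem_coe, mem_colSwap_stdCode, mem_stdCode]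
  constructor
  · rintro ⟨v, ⟨t, s, h0, h1⟩, rfl⟩
    refine ⟨e ^ k * φ t, e ^ (k + n) * φ s, ?_, ?_⟩
    · rw [swapInv_eq D hm hm0 h, Matrix.cons_val_one, Matrix.cons_val_zero, h0, map_mul, map_pow,
        ← hφ, hf]
      ring
    · rw [swapInv_eq D hm hm0 h, Matrix.cons_val_zero, h1]
      simp only [map_mul, map_add, map_pow, ← hφ, hf]
      ring
  · rintro ⟨t, s, h1, h0⟩
    set ψ := locInv D h' hm hm0 with hψ
    have hφψ : ∀ a, φ (ψ a) = a := locInv_locInv D hm hm0 h' h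
    refine ⟨![fc D l i ^ k * ψ (e' ^ k * t),
      fc D l i ^ k * ψ (e' ^ k * t) * c + fc D l i ^ (k + n) * ψ (e' ^ (k + n) * s)],
      ⟨ψ (e' ^ k * t), ψ (e' ^ (k + n) * s), rfl, rfl⟩, ?_⟩
    rw [swapInv_eq D hm hm0 h, ← vec_eta w]
    refine congrArg₂ (fun a b => ![a, b]) ?_ ?_
    · rw [h0]
      simp only [Matrix.cons_val_one, Matrix.cons_val_zero, ← hφ, map_add, map_mul, map_pow, hf,
        hφψ]
      linear_combination fc D l j ^ k * t * φ c * hee' k + fc D l j ^ (k + n) * s * hee' (k + n)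
    · rw [h1]
      simp only [Matrix.cons_val_zero, ← hφ, map_mul, map_pow, hf, hφψ]
      linear_combination fc D l j ^ k * t * hee' k

theorem swapInv_image_colSwap_stdCode (h' : IsReciprocal D j i) (k n : ℕ) (c : LocRing D l i) :
    swapInv D m l i j '' (colSwap (stdCode (fc D l i) k n c) : Set (Fin 2 → LocRing D l i)) =
      stdCode (fc D l j) k n (locInv D h hm hm0 c) := by
  have key := swapInv_image_stdCode D hm hm0 h h' k n c
  have hsw : ∀ w : Fin 2 → LocRing D l i,
      swapInv D m l i j ![w 1, w 0] = ![swapInv D m l i j w 1, swapInv D m l i j w 0] :=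
    fun w => rfl
  ext w
  rw [SetLike.mem_coe, ← colSwap_colSwap (stdCode (fc D l j) k n _), mem_colSwap, ← SetLike.mem_coe,
    ← key]
  constructor
  · rintro ⟨v, hv, rfl⟩
    exact ⟨_, mem_colSwap.mp hv, hsw v⟩
  · rintro ⟨v, hv, hvw⟩
    refine ⟨![v 1, v 0], by simpa [mem_colSwap, vec_eta] using hv, ?_⟩
    rw [hsw, hvw]
    exact vec_eta w

end LocRing

/-! ### Decomposition of `𝒜²` by the Chinese remainder theorem -/

section Decomposition

variable {m₀ ρ ε : ℕ} (D : Factorization m₀ ρ ε) {m l : ℕ} (hm : 4 * m = 2 ^ l * m₀)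

/-- The reduction `𝒜 → A_i`. -/
def proj (i : Idx ρ ε) (hm : 4 * m = 2 ^ l * m₀) : CycRing m →ₐ[ZMod 2] LocRing D l i :=
  AdjoinRoot.liftAlgHom _ (Algebra.ofId _ _) (AdjoinRoot.root _) (by
    have : aeval (AdjoinRoot.root (D.f i ^ 2 ^ l)) (X ^ (4 * m) - 1 : (ZMod 2)[X]) = 0 := by
      rw [AdjoinRoot.aeval_eq, AdjoinRoot.mk_eq_zero]
      exact pow_dvd D hm i
    exact this)

theorem proj_mk (i : Idx ρ ε) (p : (ZMod 2)[X]) :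
    proj D i hm (AdjoinRoot.mk _ p) = cls D l i p :=
  AdjoinRoot.aeval_eq p

theorem proj_root (i : Idx ρ ε) :
    proj D i hm (AdjoinRoot.root _) = AdjoinRoot.root (D.f i ^ 2 ^ l) :=
  AdjoinRoot.liftAlgHom_root _ _ _ _

theorem comp_X_pow_two_pow (p : (ZMod 2)[X]) (n : ℕ) : p.comp (X ^ 2 ^ n) = p ^ 2 ^ n := by
  rw [← expand_eq_comp_X_pow]
  induction n with
  | zero => simp
  | succ n ih => rw [pow_succ' 2 n, expand_mul, ih, map_pow, ZMod.expand_card, ← pow_mul]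

theorem mul_div_self_f (i : Idx ρ ε) :
    D.f i * ((X ^ m₀ - 1 : (ZMod 2)[X]) / D.f i) = ∏ j, D.f j := by
  rw [← D.prod_eq]
  exact EuclideanDomain.mul_div_cancel' (D.irreducible i).ne_zero
    (Finset.dvd_prod_of_mem _ (Finset.mem_univ i))

theorem proj_idem_self (i : Idx ρ ε) : proj D i hm (idem D m l i) = 1 := by
  rw [idem, proj_mk, comp_X_pow_two_pow, comp_X_pow_two_pow, ← mul_pow]
  have h1 : D.u i * ((X ^ m₀ - 1) / D.f i) = 1 - D.v i * D.f i := eq_sub_of_add_eq (D.bezout i)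
  have h2 : AdjoinRoot.mk (D.f i ^ 2 ^ l) (1 - D.v i ^ 2 ^ l * D.f i ^ 2 ^ l) = 1 := by
    rw [map_sub, map_mul, AdjoinRoot.mk_self, mul_zero, sub_zero, map_one]
  rwa [h1, sub_pow_char_pow, one_pow, mul_pow]

theorem proj_idem_of_ne {i j : Idx ρ ε} (hij : i ≠ j) : proj D j hm (idem D m l i) = 0 := by
  rw [idem, proj_mk, comp_X_pow_two_pow, comp_X_pow_two_pow, AdjoinRoot.mk_eq_zero]
  refine Dvd.dvd.mul_left (pow_dvd_pow_of_dvd ?_ _) _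
  refine (D.coprime hij.symm).dvd_of_dvd_mul_left ?_
  rw [mul_div_self_f]
  exact Finset.dvd_prod_of_mem _ (Finset.mem_univ j)

theorem phi_apply (i : Idx ρ ε) (a : LocRing D l i) :
    phi D m l i a = idem D m l i * AdjoinRoot.mk _ (rep D l i a) := rfl

theorem proj_phi_self (i : Idx ρ ε) (a : LocRing D l i) : proj D i hm (phi D m l i a) = a := by
  rw [phi_apply, map_mul, proj_idem_self, one_mul, proj_mk, cls_rep]

theorem proj_phi_of_ne {i j : Idx ρ ε} (hij : i ≠ j) (a : LocRing D l i) :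
    proj D j hm (phi D m l i a) = 0 := by
  rw [phi_apply, map_mul, proj_idem_of_ne D hm hij, zero_mul]

theorem eq_zero_of_proj {a : CycRing m} (h : ∀ i, proj D i hm a = 0) : a = 0 := by
  obtain ⟨p, rfl⟩ := AdjoinRoot.mk_surjective a
  rw [AdjoinRoot.mk_eq_zero, ← prod_pow_eq D hm]
  refine Finset.prod_dvd_of_coprime (fun i _ j _ hij => (D.coprime hij).pow) fun i _ => ?_
  have := h i
  rwa [proj_mk, AdjoinRoot.mk_eq_zero] at this

theorem sum_phi_proj (a : CycRing m) : ∑ i, phi D m l i (proj D i hm a) = a := by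
  rw [← sub_eq_zero]
  refine eq_zero_of_proj D hm fun j => ?_
  rw [map_sub, map_sum, Finset.sum_eq_single j, proj_phi_self, sub_self]
  · exact fun i _ hij => proj_phi_of_ne D hm hij _
  · simp

/-- The reduction `𝒜² → A_i²`. -/
def projPair (i : Idx ρ ε) (hm : 4 * m = 2 ^ l * m₀) (w : Fin 2 → CycRing m) :
    Fin 2 → LocRing D l i := fun s => proj D i hm (w s)

/-- The embedding `A_i² → 𝒜²` given by `φ_i` in both coordinates. -/
def phiPair (m : ℕ) (i : Idx ρ ε) (w : Fin 2 → LocRing D l i) : Fin 2 → CycRing m :=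
  fun s => phi D m l i (w s)

theorem projPair_phiPair_self (i : Idx ρ ε) (w : Fin 2 → LocRing D l i) :
    projPair D i hm (phiPair D m i w) = w := funext fun _ => proj_phi_self D hm i _

theorem projPair_phiPair_of_ne {i j : Idx ρ ε} (hij : i ≠ j) (w : Fin 2 → LocRing D l i) :
    projPair D j hm (phiPair D m i w) = 0 := funext fun _ => proj_phi_of_ne D hm hij _

theorem mem_concat {i : Idx ρ ε} {C : LinCode D l i} {w : Fin 2 → CycRing m} :
    w ∈ concat D m l i C ↔ ∃ v ∈ C, phiPair D m i v = w := Iff.rfl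

theorem mem_iSup_concat {Cs : ∀ i, LinCode D l i} {w : Fin 2 → CycRing m} :
    w ∈ ⨆ i, concat D m l i (Cs i) ↔ ∀ i, projPair D i hm w ∈ Cs i := by
  constructor
  · intro hw i
    induction hw using Submodule.iSup_induction' with
    | mem j x hx =>
      obtain ⟨v, hv, rfl⟩ := hx
      change projPair D i hm (phiPair D m j v) ∈ Cs i
      by_cases hij : j = i
      · subst hij
        rwa [projPair_phiPair_self]
      · rw [projPair_phiPair_of_ne D hm hij]
        exact zero_mem _
    | zero =>
      convert (Cs i).zero_mem using 1
      exact funext fun _ => map_zero _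
    | add x y _ _ hx hy =>
      convert (Cs i).add_mem hx hy using 1
      exact funext fun _ => map_add _ _ _
  · intro h
    have : w = ∑ i, phiPair D m i (projPair D i hm w) := by
      ext s
      rw [Finset.sum_apply]
      exact (sum_phi_proj D hm (w s)).symm
    rw [this]
    exact Submodule.sum_mem _ fun i _ =>
      Submodule.mem_iSup_of_mem i (mem_concat D |>.mpr ⟨_, h i, rfl⟩)

include hm in
theorem iSupIndep_concat (Cs : ∀ i, LinCode D l i) :
    iSupIndep fun i => concat D m l i (Cs i) := by
  intro i
  rw [Submodule.disjoint_def]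
  rintro w ⟨v, -, rfl⟩ hw
  change phiPair D m i v ∈ _ at hw
  change phiPair D m i v = 0
  have key : projPair D i hm (phiPair D m i v) = 0 := by
    generalize phiPair D m i v = x at hw ⊢
    induction hw using Submodule.iSup_induction' with
    | mem j x hx =>
      by_cases hij : j = i
      · rw [iSup_neg (by simpa using hij), Submodule.mem_bot] at hx
        rw [hx]
        exact funext fun _ => map_zero _
      · rw [iSup_pos hij] at hx
        obtain ⟨v, -, rfl⟩ := hx
        exact projPair_phiPair_of_ne D hm hij v
    | zero => exact funext fun _ => map_zero _
    | add x y _ _ hx hy =>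
      have : projPair D i hm (x + y) = projPair D i hm x + projPair D i hm y :=
        funext fun _ => map_add _ _ _
      rw [this, hx, hy, add_zero]
  rw [projPair_phiPair_self] at key
  rw [key]
  exact funext fun _ => map_zero _

/-- A family of codes decomposes `C` if and only if `C` consists of the words all of whose
reductions lie in the members of the family. -/
theorem isDecomposition_iff {C : Set (Word m)} {Cs : ∀ i, LinCode D l i} :
    IsDecomposition D m l C Cs ↔ toPair m '' C = {w | ∀ i, projPair D i hm w ∈ Cs i} := by
  have : ((⨆ i, concat D m l i (Cs i) : Submodule (ZMod 2) (Fin 2 → CycRing m)) :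
      Set (Fin 2 → CycRing m)) = {w | ∀ i, projPair D i hm w ∈ Cs i} :=
    Set.ext fun w => mem_iSup_concat D hm
  rw [IsDecomposition, this]
  exact and_iff_left (iSupIndep_concat D hm Cs)

/-- The submodule of `𝒜²` assembled from codes over all the `A_i`. -/
def glue (hm : 4 * m = 2 ^ l * m₀) (Cs : ∀ i, LinCode D l i) :
    Submodule (CycRing m) (Fin 2 → CycRing m) where
  carrier := {w | ∀ i, projPair D i hm w ∈ Cs i}
  add_mem' {a b} ha hb i := by
    convert (Cs i).add_mem (ha i) (hb i) using 1
    exact funext fun _ => map_add _ _ _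
  zero_mem' i := by
    convert (Cs i).zero_mem using 1
    exact funext fun _ => map_zero _
  smul_mem' r w hw i := by
    convert (Cs i).smul_mem (proj D i hm r) (hw i) using 1
    exact funext fun _ => map_mul _ _ _

theorem mem_glue {Cs : ∀ i, LinCode D l i} {w : Fin 2 → CycRing m} :
    w ∈ glue D hm Cs ↔ ∀ i, projPair D i hm w ∈ Cs i := Iff.rfl

theorem phiPair_mem_glue {Cs : ∀ i, LinCode D l i} {i : Idx ρ ε} {v : Fin 2 → LocRing D l i} :
    phiPair D m i v ∈ glue D hm Cs ↔ v ∈ Cs i := by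
  rw [mem_glue]
  constructor
  · intro h
    have := h i
    rwa [projPair_phiPair_self] at this
  · intro h j
    by_cases hij : i = j
    · subst hij
      rwa [projPair_phiPair_self]
    · rw [projPair_phiPair_of_ne D hm hij]
      exact zero_mem _

/-- Every submodule of `𝒜²` is assembled from codes over the `A_i`. -/
theorem exists_eq_glue (M : Submodule (CycRing m) (Fin 2 → CycRing m)) :
    ∃ Cs : ∀ i, LinCode D l i, M = glue D hm Cs := by
  refine ⟨fun i => ⟨⟨⟨{v | phiPair D m i v ∈ M}, fun {a b} ha hb => ?_⟩, ?_⟩, fun r v hv => ?_⟩, ?_⟩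
  · have : phiPair D m i (a + b) = phiPair D m i a + phiPair D m i b :=
      funext fun _ => map_add _ _ _
    exact (this ▸ M.add_mem ha hb : phiPair D m i (a + b) ∈ M)
  · have : phiPair D m i (0 : Fin 2 → LocRing D l i) = 0 :=
      funext fun _ => map_zero _
    exact (this ▸ M.zero_mem : phiPair D m i (0 : Fin 2 → LocRing D l i) ∈ M)
  · have : phiPair D m i (r • v) =
        (AdjoinRoot.mk _ (rep D l i r) : CycRing m) • phiPair D m i v := by
      ext s
      rw [← sub_eq_zero]
      refine eq_zero_of_proj D hm fun j => ?_
      by_cases hij : i = j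
      · subst hij
        simp only [phiPair, Pi.smul_apply, smul_eq_mul, map_sub, map_mul, proj_phi_self, proj_mk,
          cls_rep, sub_self]
      · simp only [phiPair, Pi.smul_apply, smul_eq_mul, map_sub, map_mul,
          proj_phi_of_ne D hm hij, mul_zero, sub_self]
    exact (this ▸ M.smul_mem _ hv : phiPair D m i (r • v) ∈ M)
  · have key : ∀ i w, phiPair D m i (projPair D i hm w) = idem D m l i • w := by
      intro i w
      ext s
      rw [← sub_eq_zero]
      refine eq_zero_of_proj D hm fun j => ?_
      by_cases hij : i = j
      · subst hij
        simp only [phiPair, projPair, Pi.smul_apply, smul_eq_mul, map_sub, map_mul, proj_phi_self,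
          proj_idem_self, one_mul, sub_self]
      · simp only [phiPair, projPair, Pi.smul_apply, smul_eq_mul, map_sub, map_mul,
          proj_phi_of_ne D hm hij, proj_idem_of_ne D hm hij, zero_mul, sub_self]
    ext w
    rw [mem_glue]
    constructor
    · intro hw i
      change phiPair D m i (projPair D i hm w) ∈ M
      rw [key]
      exact M.smul_mem _ hw
    · intro h
      have : w = ∑ i, phiPair D m i (projPair D i hm w) := by
        ext s
        rw [Finset.sum_apply]
        exact (sum_phi_proj D hm (w s)).symm
      rw [this]
      exact Submodule.sum_mem _ fun i _ => h i

/-- The orthogonal for the alternating form can be computed componentwise. -/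
theorem altDual_glue (Cs : ∀ i, LinCode D l i) :
    altDual (glue D hm Cs) = glue D hm fun i => altDual (Cs i) := by
  ext w
  rw [mem_altDual, mem_glue]
  constructor
  · intro h i v hv
    have := congrArg (proj D i hm) (h _ ((phiPair_mem_glue D hm).mpr hv))
    simpa only [phiPair, projPair, map_sub, map_mul, proj_phi_self, map_zero] using this
  · intro h v hv
    refine eq_zero_of_proj D hm fun i => ?_
    have := h i _ (hv i)
    simpa only [projPair, map_sub, map_mul] using this

end Decomposition

/-! ### The group algebra in terms of `𝒜²` -/

section GroupAlgebra

variable {m : ℕ} (hm0 : 0 < m)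

theorem root_pow_four_mul (m : ℕ) :
    AdjoinRoot.root (X ^ (4 * m) - 1 : (ZMod 2)[X]) ^ (4 * m) = 1 := by
  have := AdjoinRoot.mk_self (f := (X ^ (4 * m) - 1 : (ZMod 2)[X]))
  rwa [map_sub, map_pow, AdjoinRoot.mk_X, map_one, sub_eq_zero] at this

/-- Inversion `a(x) ↦ a(x⁻¹)` on `𝒜`, where `x⁻¹ = x^{4m-1}`. -/
def cycInv (m : ℕ) : CycRing m →ₐ[ZMod 2] CycRing m :=
  AdjoinRoot.liftAlgHom _ (Algebra.ofId _ _) (AdjoinRoot.root _ ^ (4 * m - 1)) (by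
    have : aeval (AdjoinRoot.root (X ^ (4 * m) - 1 : (ZMod 2)[X]) ^ (4 * m - 1))
        (X ^ (4 * m) - 1 : (ZMod 2)[X]) = 0 := by
      rw [map_sub, map_pow, aeval_X, map_one, ← pow_mul, mul_comm (4 * m - 1),
        pow_mul (AdjoinRoot.root _), root_pow_four_mul, one_pow, sub_self]
    exact this)

theorem cycInv_root (m : ℕ) : cycInv m (AdjoinRoot.root _) = AdjoinRoot.root _ ^ (4 * m - 1) :=
  AdjoinRoot.liftAlgHom_root _ _ _ _

include hm0 in
theorem root_mul_root_pow_sub_one :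
    AdjoinRoot.root (X ^ (4 * m) - 1 : (ZMod 2)[X]) * AdjoinRoot.root _ ^ (4 * m - 1) = 1 := by
  rw [← pow_succ', Nat.sub_add_cancel (by omega), root_pow_four_mul]

include hm0 in
theorem cycInv_cycInv (a : CycRing m) : cycInv m (cycInv m a) = a := by
  have : (cycInv m).comp (cycInv m) = AlgHom.id _ _ := by
    apply AdjoinRoot.algHom_ext
    have h1 := congrArg (cycInv m) (root_mul_root_pow_sub_one hm0)
    rw [map_mul, cycInv_root, map_one] at h1
    rw [AlgHom.comp_apply, cycInv_root, AlgHom.id_apply]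
    calc _ = (AdjoinRoot.root _ * AdjoinRoot.root _ ^ (4 * m - 1)) *
          cycInv m (AdjoinRoot.root _ ^ (4 * m - 1)) := by
          rw [root_mul_root_pow_sub_one hm0, one_mul]
      _ = _ := by rw [mul_assoc, h1, mul_one]
  exact DFunLike.congr_fun this a

/-- The map `(a(x), b(x)) ↦ (b(x⁻¹), a(x⁻¹))` on `𝒜²`, which is left multiplication by `y`. -/
def cycSwap (w : Fin 2 → CycRing m) : Fin 2 → CycRing m := ![cycInv m (w 1), cycInv m (w 0)]

theorem gx_pow (m k : ℕ) :
    gx m ^ k = MonoidAlgebra.of (ZMod 2) _ (DihedralGroup.r (k : ZMod (4 * m))) := by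
  rw [gx, ← map_pow, DihedralGroup.r_one_pow]

theorem gx_pow_four_mul (m : ℕ) : gx m ^ (4 * m) = 1 := by
  rw [gx, ← map_pow, DihedralGroup.r_one_pow_n, map_one]

theorem gy_mul_gy (m : ℕ) : gy m * gy m = 1 := by
  rw [gy, ← map_mul, DihedralGroup.sr_mul_self, map_one]

include hm0 in
theorem gy_mul_gx : gy m * gx m = gx m ^ (4 * m - 1) * gy m := by
  rw [gx_pow, gx, gy, ← map_mul, ← map_mul, DihedralGroup.sr_mul_r, DihedralGroup.r_mul_sr]
  congr 2
  rw [Nat.cast_sub (by omega), ZMod.natCast_self]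
  simp

/-- The embedding of `𝒜` into the group algebra as the polynomials in the rotation `x`. It is built
from `Ideal.Quotient.liftₐ` because `AdjoinRoot.lift` requires a commutative target. -/
def toGroupAlg (m : ℕ) : CycRing m →ₐ[ZMod 2] GroupAlg m :=
  Ideal.Quotient.liftₐ (Ideal.span {(X ^ (4 * m) - 1 : (ZMod 2)[X])}) (aeval (gx m)) (by
    intro a ha
    obtain ⟨b, rfl⟩ := Ideal.mem_span_singleton.mp ha
    rw [map_mul, map_sub, map_pow, aeval_X, map_one, gx_pow_four_mul, sub_self, zero_mul])

theorem toGroupAlg_mk (p : (ZMod 2)[X]) :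
    toGroupAlg m (AdjoinRoot.mk _ p) = aeval (gx m) p := rfl

theorem toGroupAlg_root (m : ℕ) : toGroupAlg m (AdjoinRoot.root _) = gx m := by
  rw [← AdjoinRoot.mk_X, toGroupAlg_mk, aeval_X]

include hm0 in
theorem gy_mul_toGroupAlg (a : CycRing m) :
    gy m * toGroupAlg m a = toGroupAlg m (cycInv m a) * gy m := by
  induction a using AdjoinRoot.induction_on with
  | ih p =>
    induction p using Polynomial.induction_on with
    | C r =>
      have : AdjoinRoot.mk (X ^ (4 * m) - 1 : (ZMod 2)[X]) (C r) = algebraMap (ZMod 2) _ r := rfl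
      rw [this, AlgHom.commutes, AlgHom.commutes, AlgHom.commutes, Algebra.commutes]
    | add p q hp hq => rw [map_add, map_add, map_add, map_add, mul_add, add_mul, hp, hq]
    | monomial n r ih =>
      rw [pow_succ, ← mul_assoc, map_mul _ (C r * X ^ n), AdjoinRoot.mk_X, map_mul (toGroupAlg m),
        map_mul (cycInv m), map_mul (toGroupAlg m), ← mul_assoc, ih,
        mul_assoc, mul_assoc, toGroupAlg_root, gy_mul_gx hm0, cycInv_root, map_pow,
        toGroupAlg_root]

/-- The identification `(a_0, a_1) ↦ a_0(x) + a_1(x) y` of `𝒜²` with the group algebra. -/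
def pairToGroupAlg (m : ℕ) : (Fin 2 → CycRing m) →ₗ[ZMod 2] GroupAlg m where
  toFun w := toGroupAlg m (w 0) + toGroupAlg m (w 1) * gy m
  map_add' a b := by simp only [Pi.add_apply, map_add, add_mul]; abel
  map_smul' r a := by
    simp only [Pi.smul_apply, map_smul, smul_mul_assoc, RingHom.id_apply, smul_add]

theorem pairToGroupAlg_apply (w : Fin 2 → CycRing m) :
    pairToGroupAlg m w = toGroupAlg m (w 0) + toGroupAlg m (w 1) * gy m := rfl

theorem pairToGroupAlg_smul (r : CycRing m) (w : Fin 2 → CycRing m) :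
    pairToGroupAlg m (r • w) = toGroupAlg m r * pairToGroupAlg m w := by
  simp only [pairToGroupAlg_apply, Pi.smul_apply, smul_eq_mul, map_mul, mul_add, mul_assoc]

include hm0 in
theorem pairToGroupAlg_cycSwap (w : Fin 2 → CycRing m) :
    pairToGroupAlg m (cycSwap w) = gy m * pairToGroupAlg m w := by
  simp only [pairToGroupAlg_apply, cycSwap, Matrix.cons_val_zero, Matrix.cons_val_one]
  rw [mul_add, ← mul_assoc, gy_mul_toGroupAlg hm0, gy_mul_toGroupAlg hm0, mul_assoc, gy_mul_gy,
    mul_one, add_comm]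

theorem Psi_eq (a : Word m) : Psi m a = pairToGroupAlg m (toPair m a) := by
  simp only [Psi, pairToGroupAlg_apply, toPair, map_sum, map_smul, map_pow, toGroupAlg_root,
    Finset.sum_mul, smul_mul_assoc]

theorem monic_cyc (hm0 : 0 < m) : (X ^ (4 * m) - 1 : (ZMod 2)[X]).Monic := by
  simpa using monic_X_pow_sub_C (1 : ZMod 2) (n := 4 * m) (by omega)

theorem natDegree_cyc : (X ^ (4 * m) - 1 : (ZMod 2)[X]).natDegree = 4 * m := by
  simpa using natDegree_X_pow_sub_C (n := 4 * m) (r := (1 : ZMod 2))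

include hm0 in
theorem finrank_pair : Module.finrank (ZMod 2) (Fin 2 → CycRing m) = 2 * (4 * m) := by
  have := (AdjoinRoot.powerBasis' (monic_cyc hm0)).finrank
  rw [AdjoinRoot.powerBasis'_dim, natDegree_cyc] at this
  have : Module.Finite (ZMod 2) (CycRing m) := (AdjoinRoot.powerBasis' (monic_cyc hm0)).finite
  rw [Module.finrank_pi_fintype]
  simp [*]

include hm0 in
theorem pairToGroupAlg_surjective : Function.Surjective (pairToGroupAlg m) := by
  have : NeZero (4 * m) := ⟨by omega⟩
  rw [← LinearMap.range_eq_top, eq_top_iff]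
  rintro z -
  induction z using MonoidAlgebra.induction_on with
  | of g =>
    rcases g with k | k
    · refine ⟨![AdjoinRoot.root _ ^ k.val, 0], ?_⟩
      simp [pairToGroupAlg_apply, toGroupAlg_root, gx_pow, -MonoidAlgebra.of_apply]
    · refine ⟨![0, AdjoinRoot.root _ ^ (-k).val], ?_⟩
      simp only [pairToGroupAlg_apply, Matrix.cons_val_zero, Matrix.cons_val_one, map_zero,
        zero_add, map_pow, toGroupAlg_root, gx_pow, gy]
      rw [← map_mul, DihedralGroup.r_mul_sr]
      simp [-MonoidAlgebra.of_apply]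
  | add x y hx hy => exact Submodule.add_mem _ hx hy
  | smul r x hx => exact Submodule.smul_mem _ r hx

include hm0 in
theorem pairToGroupAlg_injective : Function.Injective (pairToGroupAlg m) := by
  have : NeZero (4 * m) := ⟨by omega⟩
  have : Module.Finite (ZMod 2) (CycRing m) := (AdjoinRoot.powerBasis' (monic_cyc hm0)).finite
  have : Module.Finite (ZMod 2) (GroupAlg m) := Module.Finite.of_basis (MonoidAlgebra.basis _ _)
  rw [LinearMap.injective_iff_surjective_of_finrank_eq_finrank]
  · exact pairToGroupAlg_surjective hm0
  · rw [finrank_pair hm0,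
      Module.finrank_eq_nat_card_basis (MonoidAlgebra.basis (DihedralGroup (4 * m)) (ZMod 2)),
      DihedralGroup.nat_card]

include hm0 in
/-- Every element of `𝒜` is a polynomial of degree less than `4m` in the class of `x`. -/
theorem exists_eq_sum_root (c : CycRing m) : ∃ a : Fin (4 * m) → ZMod 2,
    c = ∑ k, a k • AdjoinRoot.root (X ^ (4 * m) - 1 : (ZMod 2)[X]) ^ (k : ℕ) := by
  obtain ⟨p, rfl⟩ := AdjoinRoot.mk_surjective c
  have hmon := monic_cyc hm0
  set q := p %ₘ (X ^ (4 * m) - 1) with hq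
  have hlt : q.natDegree < 4 * m := by
    have := natDegree_modByMonic_lt p hmon (by
      intro h; have := congrArg natDegree h; rw [natDegree_cyc, natDegree_one] at this; omega)
    rwa [natDegree_cyc] at this
  have hpq : AdjoinRoot.mk (X ^ (4 * m) - 1) p = AdjoinRoot.mk (X ^ (4 * m) - 1) q := by
    rw [AdjoinRoot.mk_eq_mk, hq, modByMonic_eq_sub_mul_div, sub_sub_cancel]
    exact dvd_mul_right _ _
  refine ⟨fun k => q.coeff k, ?_⟩
  rw [hpq]
  conv_lhs => rw [q.as_sum_range' _ hlt]
  rw [map_sum, Finset.sum_range]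
  refine Finset.sum_congr rfl fun k _ => ?_
  rw [← smul_X_eq_monomial, ← AdjoinRoot.smul_mk, map_pow, AdjoinRoot.mk_X]

include hm0 in
theorem toPair_surjective : Function.Surjective (toPair m) := by
  intro w
  choose a ha using fun j => exists_eq_sum_root hm0 (w j)
  exact ⟨fun p => a p.2 p.1, funext fun j => (ha j).symm⟩

include hm0 in
/-- A set of words is a left code if and only if it corresponds to a submodule of `𝒜²` that is
stable under left multiplication by `y`. -/
theorem isLeftDihedralCode_iff {C : Set (Word m)} :
    IsLeftDihedralCode m C ↔ ∃ M : Submodule (CycRing m) (Fin 2 → CycRing m),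
      toPair m '' C = M ∧ ∀ w ∈ M, cycSwap w ∈ M := by
  have himg : Psi m '' C = pairToGroupAlg m '' (toPair m '' C) := by
    rw [Set.image_image]
    exact Set.image_congr fun a _ => Psi_eq a
  constructor
  · rintro ⟨I, hI⟩
    refine ⟨⟨⟨⟨{w | pairToGroupAlg m w ∈ I}, fun {a b} ha hb => ?_⟩, ?_⟩, fun r w hw => ?_⟩,
      ?_, fun w hw => ?_⟩
    · change pairToGroupAlg m (a + b) ∈ I
      rw [map_add]
      exact I.add_mem ha hb
    · change pairToGroupAlg m 0 ∈ I
      rw [map_zero]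
      exact I.zero_mem
    · change pairToGroupAlg m (r • w) ∈ I
      rw [pairToGroupAlg_smul]
      exact I.mul_mem_left _ hw
    · rw [← (pairToGroupAlg_injective hm0).preimage_image (toPair m '' C), ← himg, hI]
      rfl
    · change pairToGroupAlg m (cycSwap w) ∈ I
      rw [pairToGroupAlg_cycSwap hm0]
      exact I.mul_mem_left _ hw
  · rintro ⟨M, hM, hs⟩
    refine ⟨⟨⟨⟨pairToGroupAlg m '' M, ?_⟩, ?_⟩, ?_⟩, by rw [himg, hM]; rfl⟩
    · rintro _ _ ⟨a, ha, rfl⟩ ⟨b, hb, rfl⟩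
      exact ⟨a + b, M.add_mem ha hb, map_add _ _ _⟩
    · exact ⟨0, M.zero_mem, map_zero _⟩
    · rintro z _ ⟨w, hw, rfl⟩
      obtain ⟨v, rfl⟩ := pairToGroupAlg_surjective hm0 z
      refine ⟨v 0 • w + v 1 • cycSwap w,
        M.add_mem (M.smul_mem _ hw) (M.smul_mem _ (hs w hw)), ?_⟩
      rw [map_add, pairToGroupAlg_smul, pairToGroupAlg_smul, pairToGroupAlg_cycSwap hm0,
        pairToGroupAlg_apply v, smul_eq_mul, add_mul, mul_assoc]

/-! ### The dual code -/

/-- The constant coefficient of an element of `𝒜`. -/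
def constCoeff (hm0 : 0 < m) : CycRing m →ₗ[ZMod 2] ZMod 2 :=
  (lcoeff (ZMod 2) 0).comp (AdjoinRoot.modByMonicHom (monic_cyc hm0))

theorem constCoeff_root_pow (n : ℕ) :
    constCoeff hm0 (AdjoinRoot.root _ ^ n) = if 4 * m ∣ n then 1 else 0 := by
  have h1 : AdjoinRoot.root (X ^ (4 * m) - 1 : (ZMod 2)[X]) ^ n =
      AdjoinRoot.mk _ (X ^ (n % (4 * m))) := by
    rw [map_pow, AdjoinRoot.mk_X]
    conv_lhs => rw [← Nat.mod_add_div n (4 * m), pow_add, pow_mul (AdjoinRoot.root _),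
      root_pow_four_mul, one_pow,
      mul_one]
  have h2 : (X ^ (n % (4 * m)) : (ZMod 2)[X]) %ₘ (X ^ (4 * m) - 1) = X ^ (n % (4 * m)) := by
    rw [modByMonic_eq_self_iff (monic_cyc hm0), degree_X_pow,
      degree_eq_natDegree (monic_cyc hm0).ne_zero, natDegree_cyc, Nat.cast_lt]
    exact Nat.mod_lt _ (by omega)
  rw [h1, constCoeff, LinearMap.comp_apply, AdjoinRoot.modByMonicHom_mk, h2, lcoeff_apply,
    coeff_X_pow]
  simp only [Nat.dvd_iff_mod_eq_zero, eq_comm]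

theorem eq_zero_of_constCoeff {c : CycRing m} (h : ∀ r, constCoeff hm0 (r * c) = 0) : c = 0 := by
  obtain ⟨a, rfl⟩ := exists_eq_sum_root hm0 c
  refine Finset.sum_eq_zero fun k _ => ?_
  have h1 := h (AdjoinRoot.root _ ^ (4 * m - k))
  rw [Finset.mul_sum, map_sum, Finset.sum_eq_single k] at h1
  · rw [mul_smul_comm, map_smul, ← pow_add, Nat.sub_add_cancel k.2.le, constCoeff_root_pow,
      if_pos dvd_rfl, smul_eq_mul, mul_one] at h1
    rw [h1, zero_smul]
  · intro j _ hjk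
    rw [mul_smul_comm, map_smul, ← pow_add, constCoeff_root_pow, if_neg, smul_zero]
    rintro ⟨q, hq⟩
    have hj := j.2
    have hk := k.2
    have hne : (j : ℕ) ≠ k := fun h => hjk (Fin.ext h)
    have : q ≠ 0 := by rintro rfl; omega
    have : q < 2 := by
      by_contra hq2
      have : 4 * m * 2 ≤ 4 * m * q := Nat.mul_le_mul_left _ (by omega)
      omega
    have : q = 1 := by omega
    subst this
    omega
  · simp

/-- The standard inner product of two words is the constant coefficient of
`a_0(x) b_0(x⁻¹) + a_1(x) b_1(x⁻¹)`. -/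
theorem inner_eq_constCoeff (a b : Word m) : ∑ p, a p * b p =
    constCoeff hm0 (toPair m a 0 * cycInv m (toPair m b 0) +
      toPair m a 1 * cycInv m (toPair m b 1)) := by
  have key : ∀ s, constCoeff hm0 (toPair m a s * cycInv m (toPair m b s)) =
      ∑ k, a (k, s) * b (k, s) := by
    intro s
    simp only [toPair, map_sum, map_smul, map_pow, cycInv_root]
    rw [Finset.sum_mul_sum, map_sum]
    refine Finset.sum_congr rfl fun j _ => ?_
    rw [map_sum, Finset.sum_eq_single j]
    · rw [smul_mul_smul_comm, map_smul, ← mul_pow, root_mul_root_pow_sub_one hm0, one_pow,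
        ← pow_zero (AdjoinRoot.root _), constCoeff_root_pow, if_pos (dvd_zero _), smul_eq_mul,
        mul_one]
    · intro k _ hkj
      rw [smul_mul_smul_comm, map_smul, ← pow_mul, ← pow_add, constCoeff_root_pow, if_neg,
        smul_zero]
      intro hd
      -- The exponent `j + (4m-1)k` is congruent to `j - k` modulo `4m`.
      have h1 : (j : ℕ) + (4 * m - 1) * k + k = j + 4 * m * k := by
        rw [add_assoc, ← Nat.succ_mul, Nat.succ_eq_add_one, Nat.sub_add_cancel (by omega)]
      have h2 : (k : ℕ) ≡ j [MOD 4 * m] := by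
        have e1 : (j : ℕ) + (4 * m - 1) * k + k ≡ 0 + k [MOD 4 * m] :=
          Nat.ModEq.add_right _ ((Nat.modEq_zero_iff_dvd).mpr hd)
        have e2 : (j : ℕ) + 4 * m * k ≡ j + 0 [MOD 4 * m] :=
          Nat.ModEq.add_left _ ((Nat.modEq_zero_iff_dvd).mpr (dvd_mul_right _ _))
        rw [h1] at e1
        simpa using e1.symm.trans e2
      exact hkj (Fin.ext (Nat.ModEq.eq_of_lt_of_lt h2 k.2 j.2))
    · simp
  rw [map_add, key, key, Fintype.sum_prod_type, ← Finset.sum_add_distrib]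
  exact Finset.sum_congr rfl fun k _ => Fin.sum_univ_two _

include hm0 in
/-- The dual of a left code is its orthogonal for the alternating form on `𝒜²`: stability under
left multiplication by `y` trades `b(x⁻¹)` for `b(x)` in the inner product. -/
theorem toPair_image_dualCode {C : Set (Word m)} {M : Submodule (CycRing m) (Fin 2 → CycRing m)}
    (hM : toPair m '' C = M) (hs : ∀ w ∈ M, cycSwap w ∈ M) :
    toPair m '' dualCode m C = altDual M := by
  have hdual : ∀ b, b ∈ dualCode m C ↔ toPair m b ∈ altDual M := by
    intro b
    set w := toPair m b with hw
    have h1 : b ∈ dualCode m C ↔ ∀ v ∈ M,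
        constCoeff hm0 (v 0 * cycInv m (w 0) + v 1 * cycInv m (w 1)) = 0 := by
      have hmem : ∀ v, v ∈ M ↔ ∃ a ∈ C, toPair m a = v := fun v => by
        rw [← SetLike.mem_coe, ← hM]; rfl
      constructor
      · intro hb v hv
        obtain ⟨a, ha, rfl⟩ := (hmem v).mp hv
        rw [← inner_eq_constCoeff]
        exact hb a ha
      · intro h a ha
        rw [inner_eq_constCoeff hm0]
        exact h _ ((hmem _).mpr ⟨a, ha, rfl⟩)
    have h2 : b ∈ dualCode m C ↔ ∀ v ∈ M,
        v 0 * cycInv m (w 0) + v 1 * cycInv m (w 1) = 0 := by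
      rw [h1]
      refine ⟨fun h v hv => eq_zero_of_constCoeff hm0 fun r => ?_, fun h v hv => ?_⟩
      · have := h _ (M.smul_mem r hv)
        simpa only [Pi.smul_apply, smul_eq_mul, mul_assoc, mul_add] using this
      · rw [h v hv, map_zero]
    rw [h2, mem_altDual]
    constructor
    · intro h v hv
      have := congrArg (cycInv m) (h _ (hs v hv))
      simp only [cycSwap, Matrix.cons_val_zero, Matrix.cons_val_one, map_add, map_mul, map_zero,
        cycInv_cycInv hm0] at this
      rw [ZModModule.sub_eq_add, add_comm, this]
    · intro h v hv
      have := congrArg (cycInv m) (h _ (hs v hv))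
      simp only [cycSwap, Matrix.cons_val_zero, Matrix.cons_val_one, map_sub, map_mul, map_zero,
        cycInv_cycInv hm0] at this
      rw [ZModModule.sub_eq_add] at this
      rw [add_comm, ← this]
  ext w
  constructor
  · rintro ⟨b, hb, rfl⟩
    exact (hdual b).mp hb
  · intro hw
    obtain ⟨b, rfl⟩ := toPair_surjective hm0 w
    exact ⟨b, (hdual b).mpr hw, rfl⟩

include hm0 in
theorem cycSwap_mem_altDual {M : Submodule (CycRing m) (Fin 2 → CycRing m)}
    (hs : ∀ w ∈ M, cycSwap w ∈ M) {w : Fin 2 → CycRing m} (hw : w ∈ altDual M) :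
    cycSwap w ∈ altDual M := by
  intro v hv
  have := congrArg (cycInv m) (hw _ (hs v hv))
  simp only [cycSwap, Matrix.cons_val_zero, Matrix.cons_val_one, map_sub, map_mul, map_zero,
    cycInv_cycInv hm0] at this ⊢
  linear_combination -this

end GroupAlgebra

/-! ### Stability of the components under inversion -/

section Components

variable {m₀ ρ ε : ℕ} (D : Factorization m₀ ρ ε) {m l : ℕ} (hm : 4 * m = 2 ^ l * m₀) (hm0 : 0 < m)

theorem proj_cycInv {i j : Idx ρ ε} (h : IsReciprocal D i j) (a : CycRing m) :
    proj D j hm (cycInv m a) = locInv D h hm hm0 (proj D i hm a) := by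
  have : (proj D j hm).comp (cycInv m) = (locInv D h hm hm0).comp (proj D i hm) := by
    apply AdjoinRoot.algHom_ext
    rw [AlgHom.comp_apply, AlgHom.comp_apply, cycInv_root, map_pow, proj_root, proj_root,
      locInv_root]
  exact DFunLike.congr_fun this a

include hm0 in
theorem swapInv_mem {Cs : ∀ i, LinCode D l i}
    (hs : ∀ w ∈ glue D hm Cs, cycSwap w ∈ glue D hm Cs) {i j : Idx ρ ε} (h : IsReciprocal D i j)
    {v : Fin 2 → LocRing D l i} (hv : v ∈ Cs i) : swapInv D m l i j v ∈ Cs j := by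
  have h1 := hs _ ((phiPair_mem_glue D hm).mpr hv) j
  have h2 : projPair D j hm (cycSwap (phiPair D m i v)) = swapInv D m l i j v := by
    rw [swapInv_eq D hm hm0 h, ← vec_eta (projPair D j hm _)]
    simp only [projPair, cycSwap, phiPair, Matrix.cons_val_zero, Matrix.cons_val_one,
      proj_cycInv D hm hm0 h, proj_phi_self]
  rwa [h2] at h1

include hm0 in
theorem swapInv_image_eq {Cs : ∀ i, LinCode D l i}
    (hs : ∀ w ∈ glue D hm Cs, cycSwap w ∈ glue D hm Cs) {i j : Idx ρ ε} (h : IsReciprocal D i j)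
    (h' : IsReciprocal D j i) :
    (Cs j : Set (Fin 2 → LocRing D l j)) =
      swapInv D m l i j '' (Cs i : Set (Fin 2 → LocRing D l i)) := by
  ext w
  constructor
  · intro hw
    exact ⟨_, swapInv_mem D hm hm0 hs h' hw, swapInv_swapInv D hm hm0 h' h w⟩
  · rintro ⟨v, hv, rfl⟩
    exact swapInv_mem D hm hm0 hs h hv

/-! ### Normal forms of the components -/

theorem evalInv_eq_cls (i : Idx ρ ε) (a : (ZMod 2)[X]) :
    evalInv D m l i a = cls D l i (a.comp (X ^ (4 * m - 1))) := by
  rw [evalInv, cls, ← AdjoinRoot.aeval_eq, aeval_comp, map_pow, aeval_X]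

include hm hm0 in
/-- If the code spanned by `f ^ k (1, a)` and `f ^ (k + j) (0, 1)` is stable, then comparing
`f ^ k (a(x⁻¹), 1)` with these generators gives `a(x) a(x⁻¹) ≡ 1` modulo `f ^ j`. -/
theorem mem_W_of_stable {i : Idx ρ ε} (h : IsReciprocal D i i) {k j : ℕ} (hkj : k + j ≤ 2 ^ l)
    {a : (ZMod 2)[X]} (ha : a ∈ Res D i j)
    (hs : ∀ w ∈ stdCode (fc D l i) k j (cls D l i a),
      swapInv D m l i i w ∈ stdCode (fc D l i) k j (cls D l i a)) :
    a ∈ W D m i j := by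
  have hR := isChainRing_locRing D l i
  obtain ⟨t, s, h0, h1⟩ := mem_stdCode.mp (hs ![fc D l i ^ k, fc D l i ^ k * cls D l i a]
    (Submodule.subset_span (by simp)))
  rw [swapInv_eq D hm hm0 h] at h0 h1
  set p := fc D l i
  set e := xinv D m l i ^ (D.f i).natDegree with he
  set e' : LocRing D l i := AdjoinRoot.root (D.f i ^ 2 ^ l) ^ (D.f i).natDegree with he'
  have hee : e' ^ k * e ^ k = 1 := by
    rw [← mul_pow, he, he', ← mul_pow, root_mul_xinv D hm hm0, one_pow, one_pow]
  have hf : locInv D h hm hm0 p = p * e := locInv_fc D hm hm0 h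
  simp only [Matrix.cons_val_zero, Matrix.cons_val_one, map_mul, map_pow, hf, locInv_cls] at h0 h1
  have h2 : p ^ k * (e ^ k * (1 - cls D l i a * evalInv D m l i a) - p ^ j * s) = 0 := by
    rw [pow_add] at h1
    linear_combination h1 - cls D l i a * h0
  have h3 := (pow_dvd_pow p (show j ≤ 2 ^ l - k by omega)).trans (hR.dvd_of_pow_mul_eq_zero h2)
  have h4 : p ^ j ∣ e ^ k * (1 - cls D l i a * evalInv D m l i a) := by
    simpa using dvd_add h3 (Dvd.intro s rfl)
  have h5 : p ^ j ∣ cls D l i (a * a.comp (X ^ (4 * m - 1)) - 1) := by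
    have h6 := h4.mul_left (-e' ^ k)
    have h7 : AdjoinRoot.mk (D.f i ^ 2 ^ l) (a * a.comp (X ^ (4 * m - 1)) - 1) =
        -e' ^ k * (e ^ k * (1 - cls D l i a * evalInv D m l i a)) := by
      rw [map_sub, map_mul, map_one, evalInv_eq_cls]
      linear_combination (1 - cls D l i a * cls D l i (a.comp (X ^ (4 * m - 1)))) * hee
    rwa [← h7] at h6
  exact ⟨ha, fc_pow_dvd_cls D l (by omega) h5⟩

include hm hm0 in
/-- A nonscalar code spanned by `f ^ k (c, 1)` and `f ^ (k + j) (1, 0)` with `f ∣ c` is not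
stable. -/
theorem not_stable_colSwap {i : Idx ρ ε} (h : IsReciprocal D i i) {k j : ℕ} (hj : 1 ≤ j)
    (hkj : k + j ≤ 2 ^ l) {c : LocRing D l i} (hc : fc D l i ∣ c) :
    ¬ ∀ w ∈ colSwap (stdCode (fc D l i) k j c),
      swapInv D m l i i w ∈ colSwap (stdCode (fc D l i) k j c) := by
  intro hs
  have hR := isChainRing_locRing D l i
  obtain ⟨t, s, h0, h1⟩ := mem_colSwap_stdCode.mp (hs ![fc D l i ^ k * c, fc D l i ^ k]
    (mem_colSwap_stdCode.mpr ⟨1, 0, by simp, by simp⟩))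
  rw [swapInv_eq D hm hm0 h] at h1
  obtain ⟨z, rfl⟩ := hc
  set p := fc D l i
  set e := xinv D m l i ^ (D.f i).natDegree with he
  set e' : LocRing D l i := AdjoinRoot.root (D.f i ^ 2 ^ l) ^ (D.f i).natDegree with he'
  have hee : e' ^ k * e ^ k = 1 := by
    rw [← mul_pow, he, he', ← mul_pow, root_mul_xinv D hm hm0, one_pow, one_pow]
  have hf : locInv D h hm hm0 p = p * e := locInv_fc D hm hm0 h
  simp only [Matrix.cons_val_zero, Matrix.cons_val_one, map_pow, hf] at h1
  obtain ⟨n, rfl⟩ := Nat.exists_eq_add_of_le' hj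
  have h2 : p ^ (k + 1) ∣ p ^ k := by
    refine ⟨e' ^ k * (t * z + p ^ n * s), ?_⟩
    rw [mul_pow] at h1
    linear_combination e' ^ k * h1 - p ^ k * hee
  have := hR.le_of_pow_dvd_pow (by omega) h2
  omega

/-- The matrix `H` of a form of `SelfCase` generates the orthogonal of the code generated by `G`. -/
theorem SelfCase.exists_stdCode {i : Fin (ρ + 1)} {r s : ℕ}
    {G : Matrix (Fin r) (Fin 2) (LocRing D l (self i))}
    {H : Matrix (Fin s) (Fin 2) (LocRing D l (self i))} (hG : SelfCase D m l i G H) :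
    ∃ k j k' c, k + j + k' = 2 ^ l ∧ IsGeneratorMatrix G (stdCode (fc D l (self i)) k j c) ∧
      IsGeneratorMatrix H (stdCode (fc D l (self i)) k' j c) := by
  have hR := isChainRing_locRing D l (self (ε := ε) i)
  have hN : 0 < 2 ^ l := by positivity
  cases hG with
  | I a _ =>
    exact ⟨0, 2 ^ l, 0, cls D l (self i) a, by omega,
      hR.isGeneratorMatrix_one hN (by omega) (pow_zero _).symm (one_mul _).symm,
      hR.isGeneratorMatrix_one hN (by omega) (pow_zero _).symm (one_mul _).symm⟩
  | II k hk hk' a _ =>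
    exact ⟨k, 2 ^ l - k, 0, cls D l (self i) a, by omega,
      hR.isGeneratorMatrix_one (by omega) (by omega) rfl rfl,
      hR.isGeneratorMatrix_two (by omega) (pow_zero _).symm (one_mul _).symm
        (by rw [zero_add])⟩
  | III k hk =>
    exact ⟨k, 0, 2 ^ l - k, 0, by omega, hR.isGeneratorMatrix_scalar hk,
      hR.isGeneratorMatrix_scalar (by omega)⟩
  | IV j hj hj' c _ =>
    exact ⟨0, j, 2 ^ l - j, cls D l (self i) c, by omega,
      hR.isGeneratorMatrix_two (by omega) (pow_zero _).symm (one_mul _).symm (by rw [zero_add]),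
      hR.isGeneratorMatrix_one (by omega) (by omega) rfl rfl⟩
  | V k j hk hk' hj hj' c _ =>
    exact ⟨k, j, 2 ^ l - k - j, cls D l (self i) c, by omega,
      hR.isGeneratorMatrix_two (by omega) rfl rfl rfl,
      hR.isGeneratorMatrix_two (by omega) rfl rfl (by congr 1; omega)⟩

/-- The matrices `H` and `H'` of a form of `PairCase` generate the orthogonal of the code generated
by `G` and the image of that orthogonal under `(a(x), b(x)) ↦ (b(x⁻¹), a(x⁻¹))`. -/
theorem PairCase.exists_stdCode {t : Fin ε} {r s : ℕ}
    {G : Matrix (Fin r) (Fin 2) (LocRing D l (left t))}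
    {H : Matrix (Fin s) (Fin 2) (LocRing D l (left t))}
    {H' : Matrix (Fin s) (Fin 2) (LocRing D l (right t))} (hG : PairCase D m l t G H H') :
    ∃ k j k' c, k + j + k' = 2 ^ l ∧
      ((IsGeneratorMatrix G (stdCode (fc D l (left t)) k j c) ∧
        IsGeneratorMatrix H (stdCode (fc D l (left t)) k' j c) ∧
        IsGeneratorMatrix H' (colSwap (stdCode (fc D l (right t)) k' j
          (locInv D (isReciprocal_left D t) hm hm0 c)))) ∨
      (IsGeneratorMatrix G (colSwap (stdCode (fc D l (left t)) k j c)) ∧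
        IsGeneratorMatrix H (colSwap (stdCode (fc D l (left t)) k' j c)) ∧
        IsGeneratorMatrix H' (stdCode (fc D l (right t)) k' j
          (locInv D (isReciprocal_left D t) hm hm0 c)))) := by
  have hR := isChainRing_locRing D l (left (ρ := ρ) t)
  have hR' := isChainRing_locRing D l (right (ρ := ρ) t)
  have hN : 0 < 2 ^ l := by positivity
  have hb' : ∀ b : (ZMod 2)[X], fc D l (right t) *
      (xinv D m l (right t) ^ (D.f (left t)).natDegree * evalInv D m l (right t) b) =
      locInv D (isReciprocal_left D t) hm hm0 (fc D l (left t) * cls D l (left t) b) := fun b => by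
    rw [map_mul, locInv_fc, locInv_cls, mul_assoc]
  cases hG with
  | case1 a _ =>
    exact ⟨0, 2 ^ l, 0, cls D l (left t) a, by omega, Or.inl
      ⟨hR.isGeneratorMatrix_one hN (by omega) (pow_zero _).symm (one_mul _).symm,
      hR.isGeneratorMatrix_one hN (by omega) (pow_zero _).symm (one_mul _).symm,
      (hR'.isGeneratorMatrix_one hN (by omega) (pow_zero _).symm (one_mul _).symm).colSwap_row⟩⟩
  | case2 k hk hk' a _ =>
    exact ⟨k, 2 ^ l - k, 0, cls D l (left t) a, by omega, Or.inl
      ⟨hR.isGeneratorMatrix_one (by omega) (by omega) rfl rfl,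
      hR.isGeneratorMatrix_two (by omega) (pow_zero _).symm (one_mul _).symm (by rw [zero_add]),
      (hR'.isGeneratorMatrix_two (by omega) (pow_zero _).symm (one_mul _).symm
        (by rw [zero_add])).colSwap_rows⟩⟩
  | case3 b _ =>
    rw [hb']
    exact ⟨0, 2 ^ l, 0, fc D l (left t) * cls D l (left t) b, by omega, Or.inr
      ⟨(hR.isGeneratorMatrix_one hN (by omega) (pow_zero _).symm (one_mul _).symm).colSwap_row,
      (hR.isGeneratorMatrix_one hN (by omega) (pow_zero _).symm (one_mul _).symm).colSwap_row,
      hR'.isGeneratorMatrix_one hN (by omega) (pow_zero _).symm (one_mul _).symm⟩⟩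
  | case4 k hk hk' b _ =>
    rw [hb']
    exact ⟨k, 2 ^ l - k, 0, fc D l (left t) * cls D l (left t) b, by omega, Or.inr
      ⟨(hR.isGeneratorMatrix_one (by omega) (by omega) rfl
        (by rw [pow_succ, mul_assoc])).colSwap_row,
      (hR.isGeneratorMatrix_two (by omega) (pow_zero _).symm (one_mul _).symm
        (by rw [zero_add])).colSwap_rows,
      hR'.isGeneratorMatrix_two (by omega) (pow_zero _).symm (one_mul _).symm
        (by rw [zero_add])⟩⟩
  | case5 k hk =>
    refine ⟨k, 0, 2 ^ l - k, 0, by omega, Or.inl ⟨hR.isGeneratorMatrix_scalar hk,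
      hR.isGeneratorMatrix_scalar (by omega), ?_⟩⟩
    -- A scalar matrix generates the same code after an exchange of the coordinates.
    have h0 : colSwap (stdCode (fc D l (right t)) (2 ^ l - k) 0 0) =
        stdCode (fc D l (right t)) (2 ^ l - k) 0 0 := by
      ext w
      rw [mem_colSwap_stdCode, mem_stdCode]
      constructor
      · rintro ⟨a, b, h1, h2⟩
        exact ⟨b, a, by simpa using h2, by simpa using h1⟩
      · rintro ⟨a, b, h1, h2⟩
        exact ⟨b, a, by simpa using h2, by simpa using h1⟩
    rw [map_zero, h0]
    exact hR'.isGeneratorMatrix_scalar (by omega)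
  | case6 j hj hj' c _ =>
    exact ⟨0, j, 2 ^ l - j, cls D l (left t) c, by omega, Or.inl
      ⟨hR.isGeneratorMatrix_two (by omega) (pow_zero _).symm (one_mul _).symm (by rw [zero_add]),
      hR.isGeneratorMatrix_one (by omega) (by omega) rfl rfl,
      (hR'.isGeneratorMatrix_one (by omega) (by omega) rfl rfl).colSwap_row⟩⟩
  | case7 k j hk hk' hj hj' c _ =>
    exact ⟨k, j, 2 ^ l - k - j, cls D l (left t) c, by omega, Or.inl
      ⟨hR.isGeneratorMatrix_two (by omega) rfl rfl rfl,
      hR.isGeneratorMatrix_two (by omega) rfl rfl (by congr 1; omega),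
      (hR'.isGeneratorMatrix_two (by omega) rfl rfl (by congr 1; omega)).colSwap_rows⟩⟩
  | case8 j hj hj' c _ =>
    exact ⟨0, j, 2 ^ l - j, cls D l (left t) c, by omega, Or.inr
      ⟨(hR.isGeneratorMatrix_two (by omega) (pow_zero _).symm (one_mul _).symm
        (by rw [zero_add])).colSwap_rows,
      (hR.isGeneratorMatrix_one (by omega) (by omega) rfl rfl).colSwap_row,
      hR'.isGeneratorMatrix_one (by omega) (by omega) rfl rfl⟩⟩
  | case9 k j hk hk' hj hj' c _ =>
    exact ⟨k, j, 2 ^ l - k - j, cls D l (left t) c, by omega, Or.inr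
      ⟨(hR.isGeneratorMatrix_two (by omega) rfl rfl rfl).colSwap_rows,
      (hR.isGeneratorMatrix_two (by omega) rfl rfl (by congr 1; omega)).colSwap_rows,
      hR'.isGeneratorMatrix_two (by omega) rfl rfl (by congr 1; omega)⟩⟩

include hm hm0 in
theorem exists_selfCase (i : Fin (ρ + 1)) (C : LinCode D l (self i))
    (hs : ∀ w ∈ C, swapInv D m l (self i) (self i) w ∈ C) :
    ∃ (r s : ℕ) (G : Matrix (Fin r) (Fin 2) (LocRing D l (self i)))
      (H : Matrix (Fin s) (Fin 2) (LocRing D l (self i))),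
      SelfCase D m l i G H ∧ IsGeneratorMatrix G C := by
  have hR := isChainRing_locRing D l (self (ε := ε) i)
  have hN : 0 < 2 ^ l := by positivity
  have hrec := isReciprocal_self D i
  rcases hR.exists_normalForm C with ⟨k, j, c, hkj, rfl⟩ | ⟨k, j, c, hj, hkj, hc, rfl⟩
  · obtain ⟨a, ha, hca⟩ := exists_res D l (self i) j c
    rw [stdCode_congr hca] at hs ⊢
    have haW := mem_W_of_stable D hm hm0 hrec hkj ha hs
    rcases Nat.eq_zero_or_pos j with rfl | hj
    · rw [stdCode_congr (c' := 0) (by simp)]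
      exact ⟨_, _, _, _, .III k hkj, hR.isGeneratorMatrix_scalar hkj⟩
    rcases hkj.eq_or_lt with hkj | hkj <;> rcases Nat.eq_zero_or_pos k with rfl | hk
    · obtain rfl : j = 2 ^ l := by omega
      exact ⟨_, _, _, _, .I a haW,
        hR.isGeneratorMatrix_one hN hkj (pow_zero _).symm (one_mul _).symm⟩
    · obtain rfl : j = 2 ^ l - k := by omega
      exact ⟨_, _, _, _, .II k hk (by omega) a haW,
        hR.isGeneratorMatrix_one (by omega) hkj rfl rfl⟩
    · exact ⟨_, _, _, _, .IV j hj (by omega) a haW,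
        hR.isGeneratorMatrix_two hkj (pow_zero _).symm (one_mul _).symm (by rw [zero_add])⟩
    · exact ⟨_, _, _, _, .V k j hk (by omega) hj (by omega) a haW,
        hR.isGeneratorMatrix_two hkj rfl rfl rfl⟩
  · exact absurd hs (not_stable_colSwap D hm hm0 hrec hj hkj hc)

variable (m) in
theorem exists_pairCase (t : Fin ε) (C : LinCode D l (left t)) :
    ∃ (r s : ℕ) (G : Matrix (Fin r) (Fin 2) (LocRing D l (left t)))
      (H : Matrix (Fin s) (Fin 2) (LocRing D l (left t)))
      (H' : Matrix (Fin s) (Fin 2) (LocRing D l (right t))),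
      PairCase D m l t G H H' ∧ IsGeneratorMatrix G C := by
  have hR := isChainRing_locRing D l (left (ρ := ρ) t)
  have hN : 0 < 2 ^ l := by positivity
  rcases hR.exists_normalForm C with ⟨k, j, c, hkj, rfl⟩ | ⟨k, j, c, hj, hkj, hc, rfl⟩
  · obtain ⟨a, ha, hca⟩ := exists_res D l (left t) j c
    rw [stdCode_congr hca]
    rcases Nat.eq_zero_or_pos j with rfl | hj
    · rw [stdCode_congr (c' := 0) (by simp)]
      exact ⟨_, _, _, _, _, .case5 k hkj, hR.isGeneratorMatrix_scalar hkj⟩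
    rcases hkj.eq_or_lt with hkj | hkj <;> rcases Nat.eq_zero_or_pos k with rfl | hk
    · obtain rfl : j = 2 ^ l := by omega
      exact ⟨_, _, _, _, _, .case1 a ha,
        hR.isGeneratorMatrix_one hN hkj (pow_zero _).symm (one_mul _).symm⟩
    · obtain rfl : j = 2 ^ l - k := by omega
      exact ⟨_, _, _, _, _, .case2 k hk (by omega) a ha,
        hR.isGeneratorMatrix_one (by omega) hkj rfl rfl⟩
    · exact ⟨_, _, _, _, _, .case6 j hj (by omega) a ha,
        hR.isGeneratorMatrix_two hkj (pow_zero _).symm (one_mul _).symm (by rw [zero_add])⟩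
    · exact ⟨_, _, _, _, _, .case7 k j hk (by omega) hj (by omega) a ha,
        hR.isGeneratorMatrix_two hkj rfl rfl rfl⟩
  · obtain ⟨a, ha, hca⟩ := exists_res D l (left t) j c
    rw [stdCode_congr hca]
    have haf : a ∈ ResMul D (left t) j := by
      refine ⟨ha, ?_⟩
      have h1 : fc D l (left t) ∣ cls D l (left t) a :=
        (dvd_sub_right hc).mp ((dvd_pow_self _ (by omega)).trans hca)
      rw [← pow_one (D.f _)]
      exact fc_pow_dvd_cls D l (s := 1) hN (by rwa [pow_one])
    rcases hkj.eq_or_lt with hkj | hkj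
    · obtain ⟨b, hb, rfl⟩ := exists_res_of_mem_resMul D hj haf
      have hab : cls D l (left t) (D.f (left t) * b) = fc D l (left t) * cls D l (left t) b :=
        map_mul (AdjoinRoot.mk _) _ _
      rw [hab]
      rcases Nat.eq_zero_or_pos k with rfl | hk
      · obtain rfl : j = 2 ^ l := by omega
        exact ⟨_, _, _, _, _, .case3 b hb,
          (hR.isGeneratorMatrix_one hN hkj (pow_zero _).symm (one_mul _).symm).colSwap_row⟩
      · obtain rfl : j = 2 ^ l - k := by omega
        exact ⟨_, _, _, _, _, .case4 k hk (by omega) b hb,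
          (hR.isGeneratorMatrix_one (by omega) hkj rfl
            (by rw [pow_succ, mul_assoc])).colSwap_row⟩
    · rcases Nat.eq_zero_or_pos k with rfl | hk
      · exact ⟨_, _, _, _, _, .case8 j hj (by omega) a haf,
          (hR.isGeneratorMatrix_two hkj (pow_zero _).symm (one_mul _).symm
            (by rw [zero_add])).colSwap_rows⟩
      · exact ⟨_, _, _, _, _, .case9 k j hk (by omega) hj (by omega) a haf,
          (hR.isGeneratorMatrix_two hkj rfl rfl rfl).colSwap_rows⟩

end Components

end DihedralCode

end

theorem mainTheorem5 (m m₀ l₀ l ρ ε : ℕ) (hm₀ : Odd m₀) (hm : m = 2 ^ l₀ * m₀) (hl : l = l₀ + 2)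
    (D : DihedralCode.Factorization m₀ ρ ε)
    (C : Set (DihedralCode.Word m)) (hC : DihedralCode.IsLeftDihedralCode m C) :
    DihedralCode.IsLeftDihedralCode m (DihedralCode.dualCode m C) ∧
    (∃ Cs : ∀ i, DihedralCode.LinCode D l i, DihedralCode.IsDecomposition D m l C Cs) ∧
    ∀ Cs : ∀ i, DihedralCode.LinCode D l i, DihedralCode.IsDecomposition D m l C Cs →
      ∃ Q : ∀ i, DihedralCode.LinCode D l i,
        DihedralCode.IsCanonicalForm D m l (DihedralCode.dualCode m C) Q ∧
        (∀ i : Fin (ρ + 1),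
          (∃ (r s : ℕ)
            (G : Matrix (Fin r) (Fin 2) (DihedralCode.LocRing D l (DihedralCode.self i)))
            (H : Matrix (Fin s) (Fin 2) (DihedralCode.LocRing D l (DihedralCode.self i))),
            DihedralCode.SelfCase D m l i G H ∧
            DihedralCode.IsGeneratorMatrix G (Cs (DihedralCode.self i))) ∧
          ∀ (r s : ℕ)
            (G : Matrix (Fin r) (Fin 2) (DihedralCode.LocRing D l (DihedralCode.self i)))
            (H : Matrix (Fin s) (Fin 2) (DihedralCode.LocRing D l (DihedralCode.self i))),
            DihedralCode.SelfCase D m l i G H →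
            DihedralCode.IsGeneratorMatrix G (Cs (DihedralCode.self i)) →
            DihedralCode.IsGeneratorMatrix H (Q (DihedralCode.self i))) ∧
        (∀ t : Fin ε,
          (∃ (r s : ℕ)
            (G : Matrix (Fin r) (Fin 2) (DihedralCode.LocRing D l (DihedralCode.left t)))
            (H : Matrix (Fin s) (Fin 2) (DihedralCode.LocRing D l (DihedralCode.left t)))
            (H' : Matrix (Fin s) (Fin 2) (DihedralCode.LocRing D l (DihedralCode.right t))),
            DihedralCode.PairCase D m l t G H H' ∧
            DihedralCode.IsGeneratorMatrix G (Cs (DihedralCode.left t))) ∧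
          ∀ (r s : ℕ)
            (G : Matrix (Fin r) (Fin 2) (DihedralCode.LocRing D l (DihedralCode.left t)))
            (H : Matrix (Fin s) (Fin 2) (DihedralCode.LocRing D l (DihedralCode.left t)))
            (H' : Matrix (Fin s) (Fin 2) (DihedralCode.LocRing D l (DihedralCode.right t))),
            DihedralCode.PairCase D m l t G H H' →
            DihedralCode.IsGeneratorMatrix G (Cs (DihedralCode.left t)) →
            DihedralCode.IsGeneratorMatrix H (Q (DihedralCode.left t)) ∧
            DihedralCode.IsGeneratorMatrix H' (Q (DihedralCode.right t))) := by
  have hpos : 0 < m := by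
    rw [hm]
    exact Nat.mul_pos (by positivity) hm₀.pos
  have hfac : 4 * m = 2 ^ l * m₀ := by rw [hm, hl, pow_add]; ring
  obtain ⟨M, hM, hs⟩ := (DihedralCode.isLeftDihedralCode_iff hpos).mp hC
  have hdual := DihedralCode.toPair_image_dualCode hpos hM hs
  have hsdual := fun w => DihedralCode.cycSwap_mem_altDual hpos hs (w := w)
  refine ⟨(DihedralCode.isLeftDihedralCode_iff hpos).mpr ⟨_, hdual, hsdual⟩, ?_, fun Cs hCs => ?_⟩
  · obtain ⟨Cs, rfl⟩ := DihedralCode.exists_eq_glue D hfac M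
    exact ⟨Cs, (DihedralCode.isDecomposition_iff D hfac).mpr hM⟩
  · obtain rfl : M = DihedralCode.glue D hfac Cs := SetLike.coe_injective
      (hM.symm.trans ((DihedralCode.isDecomposition_iff D hfac).mp hCs))
    rw [DihedralCode.altDual_glue] at hdual hsdual
    have hQ : ∀ {i : DihedralCode.Idx ρ ε} {k j k' : ℕ} {c : DihedralCode.LocRing D l i},
        k + j + k' = 2 ^ l →
        DihedralCode.altDual (DihedralCode.stdCode (DihedralCode.fc D l i) k j c) =
          DihedralCode.stdCode (DihedralCode.fc D l i) k' j c := by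
      intro i k j k' c h
      rw [(DihedralCode.isChainRing_locRing D l i).altDual_stdCode (by omega)]
      congr 1
      omega
    -- The dual is again stable under left multiplication by `y`, so its component at `i + ε` is
    -- the image of its component at `i`.
    have hright : ∀ t : Fin ε, _ := fun t => DihedralCode.swapInv_image_eq D hfac hpos hsdual
      (DihedralCode.isReciprocal_left D t) (DihedralCode.isReciprocal_right D hfac hpos t)
    refine ⟨fun i => DihedralCode.altDual (Cs i),
      ⟨(DihedralCode.isDecomposition_iff D hfac).mpr hdual, fun i w hw =>
        DihedralCode.swapInv_mem D hfac hpos hsdual (DihedralCode.isReciprocal_self D i) hw,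
        hright⟩, fun i => ⟨?_, ?_⟩, fun t => ⟨?_, ?_⟩⟩
    · exact DihedralCode.exists_selfCase D hfac hpos i _ fun w hw =>
        DihedralCode.swapInv_mem D hfac hpos hs (DihedralCode.isReciprocal_self D i) hw
    · intro r s G H hGH hG
      obtain ⟨k, j, k', c, hk, h1, h2⟩ := DihedralCode.SelfCase.exists_stdCode D hGH
      change DihedralCode.IsGeneratorMatrix H (DihedralCode.altDual (Cs _))
      rwa [hG.eq h1, hQ hk]
    · exact DihedralCode.exists_pairCase D m t _
    · intro r s G H H' hGH hG
      have himg := hright t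
      change DihedralCode.IsGeneratorMatrix H (DihedralCode.altDual (Cs _)) ∧
        DihedralCode.IsGeneratorMatrix H' (DihedralCode.altDual (Cs _))
      obtain ⟨k, j, k', c, hk, ⟨h1, h2, h3⟩ | ⟨h1, h2, h3⟩⟩ :=
        DihedralCode.PairCase.exists_stdCode D hfac hpos hGH
      · rw [hG.eq h1, hQ hk, DihedralCode.swapInv_image_stdCode D hfac hpos
          (DihedralCode.isReciprocal_left D t)
          (DihedralCode.isReciprocal_right D hfac hpos t)] at himg
        rw [hG.eq h1, hQ hk, SetLike.coe_injective himg]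
        exact ⟨h2, h3⟩
      · rw [hG.eq h1, DihedralCode.altDual_colSwap, hQ hk,
          DihedralCode.swapInv_image_colSwap_stdCode D hfac hpos
          (DihedralCode.isReciprocal_left D t)
          (DihedralCode.isReciprocal_right D hfac hpos t)] at himg
        rw [hG.eq h1, DihedralCode.altDual_colSwap, hQ hk, SetLike.coe_injective himg]
        exact ⟨h2, h3⟩
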